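/- **Model.** Let $T>0$, $x_0>0$ and let $(\Omega,\mathcal A,\mathbb P)$ be a complete probability space carrying a standard Wiener process $W$; a Poisson random measure $N(dt,dz)$ on $[0,\infty)\times\mathbb R_0$, $\mathbb R_0=\mathbb R\setminus\{0\}$, independent of $W$, with intensity $dt\,\nu(dz)$, where $\nu$ is $\sigma$-finite and $\int z^2\nu(dz)<\infty$ (write $\tilde N(dt,dz)=N(dt,dz)-\nu(dz)dt$); a càdlàg counting process $H$ with $\mathbb E[H(T)]<\infty$ that a.s. has jumps of size $1$ only and no jump in common with $N$ on $[0,T]$; and a $\mathbb P$-augmented right-continuous filtration $\mathbb G=(\mathcal G_t)_{t\ge0}$, with $\Lambda$ the $\mathbb G$-predictable intensity of $H$. The coefficients $\rho,\mu,\sigma,\kappa$ (processes) and $\theta=\theta(t,z)$ (a random field) are jointly measurable and càglàd, not necessarily adapted, with $\mathbb E\big[\int_0^T(|\mu|+\sigma^2+\int_{\mathbb R_0}\theta^2\,d\nu)\,ds+\int_0^T|\kappa|\,d\Lambda\big]<\infty$, $\theta>-1$ and $\kappa\ge-1$ almost everywhere, $\sigma$ forward integrable with respect to $W$, and $\theta,\ln(1+\theta)$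 forward integrable with respect to $\tilde N$. *Forward integrals.* $\varphi$ is forward integrable with respect to $W$, with integral process $\int_0^t\varphi\,d^-W$, if $\mathbb E\sup_{t\le T}\big|\int_0^t\varphi(s)\frac{W(s+\epsilon)-W(s)}{\epsilon}ds-\int_0^t\varphi\,d^-W\big|\to0$ as $\epsilon\to0^+$. Fix an increasing sequence of compact sets $K_m\subset\mathbb R_0$ with $\nu(K_m)<\infty$ and $\bigcup_mK_m=\mathbb R_0$. For a càglàd random field $\varphi$, $\int_0^t\int\varphi(s,z)\tilde N(d^-s,dz)$ is the $L^2(\mathbb P)$-limit as $m\to\infty$ of $\int_0^t\int_{K_m}\varphi(s,z)\tilde N(ds,dz)$; $\varphi$ is forward integrable with respect to $\tilde N$ if these truncated integrals exist and the limit exists up to every $t\in[0,T]$ and up to the random time $\tau$ below. Integrals with respect to $H$ are pathwise. The asset price is $S_1(t)=S_1(0)\prod_{s\le t,\,\Delta H(s)>0}(1+\kappa(s)\Delta H(s))\exp\{\int_0^t(\mu-\frac12\sigma^2)ds+\int_0^t\sigma\,d^-W+\int_0^t\int[\ln(1+\theta)-\theta]\,d\nu\,ds+\int_0^t\int\ln(1+\theta)\,\tilde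 N(d^-s,dz)\}$, $S_1(0)>0$, and $\tau\le T$ is a $\mathbb G$-stopping time with $\tau\le\inf\{t\in[0,T]:S_1(t)=0\}$. **Admissible portfolios.** $\mathcal A_{\mathbb G}$ is the set of càglàd $\mathbb G$-adapted processes $\pi$ on $[0,T]$ such that for some $\epsilon_\pi>0$, a.s. $\pi(t)\kappa(t)>-1+\epsilon_\pi$ and $\pi(t)\theta(t,z)>-1+\epsilon_\pi$ for all $t\in[0,T]$ (and all $z$ outside a fixed $\nu$-null set); $\mathbb E\int_0^T(|\mu-\rho||\pi|+\sigma^2\pi^2)ds<\infty$ and $\mathbb E\int_0^T\int|\theta\pi|^2d\nu\,ds<\infty$; $\pi\sigma$ is càglàd and forward integrable with respect to $W$; and $\pi\theta$, $\ln(1+\pi\theta)$, $\frac{\pi\theta}{1+\pi\theta}$ are càglàd and forward integrable with respect to $\tilde N$. The final wealth is $$X_\pi(T)=x_0\exp\Big\{\int_0^\tau\big[\rho+(\mu-\rho)\pi-\tfrac12\sigma^2\pi^2\big]ds+\int_0^\tau\!\!\int_{\mathbb R_0}[\ln(1+\pi\theta)-\pi\theta]\,d\nu\,ds+\int_0^\tau\pi\sigma\,d^-W+\int_0^\tau\!\!\int_{\mathbb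 R_0}\ln(1+\pi\theta)\,\tilde N(d^-s,dz)+\int_0^\tau\ln(1+\kappa\pi)\,dH+\int_\tau^T\rho\,ds\Big\}.$$ For $y\in\mathbb R$ let $$\Psi(y,\beta,\pi)=\int_0^\tau\beta\big[\mu-\rho-(\pi+y\beta)\sigma^2\big]ds+\int_0^\tau\!\!\int_{\mathbb R_0}\Big[\tfrac{\beta\theta}{1+(\pi+y\beta)\theta}-\beta\theta\Big]d\nu\,ds+\int_0^\tau\beta\sigma\,d^-W+\int_0^\tau\!\!\int_{\mathbb R_0}\tfrac{\beta\theta}{1+(\pi+y\beta)\theta}\,\tilde N(d^-s,dz)+\int_0^\tau\tfrac{\beta\kappa}{1+\kappa(\pi+y\beta)}\,dH,$$ $$\Psi_y(y,\beta,\pi)=-\int_0^\tau\beta^2\sigma^2ds-\int_0^\tau\!\!\int_{\mathbb R_0}\tfrac{\beta^2\theta^2}{[1+(\pi+y\beta)\theta]^2}\,N(ds,dz)-\int_0^\tau\tfrac{\beta^2\kappa^2}{[1+(\pi+y\beta)\kappa]^2}\,dH.$$ **Assumptions.** Let $\pi\in\mathcal A_{\mathbb G}$, let $U$ be a real function on $(0,\infty)$,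 and for every bounded $\beta\in\mathcal A_{\mathbb G}$ let $\delta_{\pi,\beta}>0$. $A_{\text{u.i.}}$: $U(X_\pi(T))$ and $U'(X_\pi(T))X_\pi(T)$ are integrable, $\mathbb E[U'(X_\pi(T))X_\pi(T)]>0$, and for every bounded $\beta\in\mathcal A_{\mathbb G}$ and all $|y|<\delta_{\pi,\beta}$, $X_{\pi+y\beta}(T)$ and $\Psi(y,\beta,\pi)$ are well defined (that is, $\pi+y\beta\in\mathcal A_{\mathbb G}$ and $\frac{\beta\theta}{1+(\pi+y\beta)\theta}$ is forward integrable with respect to $\tilde N$), and the family $\{U'(X_{\pi+y\beta}(T))X_{\pi+y\beta}(T)|\Psi(y,\beta,\pi)|\}_{|y|<\delta_{\pi,\beta}}$ is uniformly integrable. $A_{d^2}$: $U$ is twice differentiable, strictly increasing and concave, and for every bounded $\beta\in\mathcal A_{\mathbb G}$ the variables $\Psi_y(y,\beta,\pi)$, $|y|<\delta_{\pi,\beta}$, are a.s. finite and the family $$\big\{U''(X_{\pi+y\beta}(T))X_{\pi+y\beta}(T)^2\,\Psi^2+U'(X_{\pi+y\beta}(T))X_{\pi+y\beta}(T)\,[\Psi^2+\Psi_y]\big\}_{|y|<\delta_{\pi,\beta}},\qquad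 \Psi=\Psi(y,\beta,\pi),\ \Psi_y=\Psi_y(y,\beta,\pi),$$ is uniformly integrable. **Lemma.** Let $\pi\in\mathcal A_{\mathbb G}$ be such that $A_{\text{u.i.}}$ and $A_{d^2}$ hold with radii $\delta_{\pi,\beta}$, and suppose $xU''(x)+U'(x)\le0$ for all $x>0$. Then for every bounded $\beta\in\mathcal A_{\mathbb G}$, $U(X_{\pi+y\beta}(T))$ is integrable for all $|y|<\delta_{\pi,\beta}$ and the map $y\mapsto\mathbb E[U(X_{\pi+y\beta}(T))]$ is concave on $(-\delta_{\pi,\beta},\delta_{\pi,\beta})$. -/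

import Mathlib

open MeasureTheory ProbabilityTheory Filter Topology Set
open scoped NNReal ENNReal

noncomputable section

/-- `f` is càglàd (left-continuous with right limits) on `[0, T]`. -/
def IsCaglad (T : ℝ) (f : ℝ → ℝ) : Prop :=
  (∀ t ∈ Ioc 0 T, Tendsto f (𝓝[<] t) (𝓝 (f t))) ∧
    ∀ t ∈ Ico 0 T, ∃ l : ℝ, Tendsto f (𝓝[>] t) (𝓝 l)

/-- `N` is a Poisson random measure on `E` with intensity measure `m`. -/
structure IsPoissonRandomMeasure {Ω E : Type*} [MeasurableSpace Ω] [MeasurableSpace E]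
    (N : Ω → Measure E) (m : Measure E) (P : Measure Ω) : Prop where
  measurable : Measurable N
  poisson : ∀ B : Set E, MeasurableSet B → m B ≠ ∞ →
    P.map (fun ω => N ω B) =
      (poissonMeasure (m B).toNNReal).map (fun n : ℕ => (n : ℝ≥0∞))
  indep : ∀ (n : ℕ) (B : Fin n → Set E), (∀ i, MeasurableSet (B i)) →
    Pairwise (fun i j => Disjoint (B i) (B j)) → iIndepFun (fun i ω => N ω (B i)) P

/-- The data of the market model. Processes are functions of `(t, ω)` (fields of `(t, z, ω)`), of
which only the values at `t ∈ [0, T]` (and `z ≠ 0`) matter. The laws are in `Market.Standing`. -/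
structure Market (Ω : Type*) [MeasurableSpace Ω] where
  /-- the probability measure -/
  P : Measure Ω
  /-- the time horizon -/
  T : ℝ
  /-- the initial wealth -/
  x₀ : ℝ
  /-- the initial price of the defaultable asset -/
  s₀ : ℝ
  /-- the Wiener process -/
  W : ℝ≥0 → Ω → ℝ
  /-- the jump measure on `ℝ \ {0}` -/
  ν : Measure ℝ
  /-- the Poisson random measure `N(dt, dz)` -/
  N : Ω → Measure (ℝ × ℝ)
  /-- the increasing sequence of compact subsets of `ℝ \ {0}` along which the integrals with
  respect to the compensated Poisson random measure are truncated -/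
  K : ℕ → Set ℝ
  /-- the counting process of the defaults; its paths are nondecreasing and right-continuous,
  and `dH` is the Lebesgue-Stieltjes measure of the path -/
  H : Ω → StieltjesFunction ℝ
  /-- the intensity of `H` -/
  Λ : Ω → Measure ℝ
  /-- the information flow of the investor -/
  G : Filtration ℝ≥0 ‹MeasurableSpace Ω›
  /-- the interest rate -/
  ρ : ℝ → Ω → ℝ
  /-- the drift -/
  μ : ℝ → Ω → ℝ
  /-- the volatility -/
  σ : ℝ → Ω → ℝ
  /-- the coefficient of `dH` -/
  κ : ℝ → Ω → ℝ
  /-- the coefficient of the compensated Poisson random measure -/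
  θ : ℝ → ℝ → Ω → ℝ
  /-- the time after which the asset is not traded any more -/
  τ : Ω → ℝ≥0

namespace Market

variable {Ω : Type*} [MeasurableSpace Ω]

/-! ### Forward integrals -/

/-- `∫₀ᵗ φ(s) (W(s+ε) - W(s)) / ε ds`. -/
def approxW (M : Market Ω) (φ : ℝ → Ω → ℝ) (ε t : ℝ) (ω : Ω) : ℝ :=
  ∫ s in Ioc 0 t, φ s ω * ((M.W (s + ε).toNNReal ω - M.W s.toNNReal ω) / ε)

/-- `I` is the forward integral process `t ↦ ∫₀ᵗ φ d⁻W` on `[0, T]`. As an `L¹`-limit, uniform in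
time, of processes with continuous paths, such a process is measurable and has almost surely
continuous paths; this is recorded so that the supremum below is a random variable. -/
structure IsForwardIntegralW (M : Market Ω) (φ I : ℝ → Ω → ℝ) : Prop where
  measurable : ∀ t ∈ Icc 0 M.T, AEStronglyMeasurable (I t) M.P
  continuous : ∀ᵐ ω ∂M.P, ContinuousOn (fun t => I t ω) (Icc 0 M.T)
  tendsto : Tendsto
    (fun ε : ℝ => ∫⁻ ω, ⨆ t ∈ Icc 0 M.T, ‖M.approxW φ ε t ω - I t ω‖ₑ ∂M.P) (𝓝[>] 0) (𝓝 0)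

/-- `φ` is forward integrable with respect to `W`. -/
def ForwardIntegrableW (M : Market Ω) (φ : ℝ → Ω → ℝ) : Prop :=
  ∃ I, M.IsForwardIntegralW φ I

open Classical in
/-- The forward integral `∫₀ᵗ φ d⁻W` (`0` if `φ` is not forward integrable). -/
def forwardW (M : Market Ω) (φ : ℝ → Ω → ℝ) : ℝ → Ω → ℝ :=
  if h : M.ForwardIntegrableW φ then h.choose else 0

/-- `∫₀ᵗ ∫_{K m} φ(s, z) Ñ(ds, dz)`, where `Ñ(ds, dz) = N(ds, dz) - ν(dz) ds`. -/
def truncN (M : Market Ω) (φ : ℝ → ℝ → Ω → ℝ) (m : ℕ) (t : ℝ) (ω : Ω) : ℝ :=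
  (∫ p in Ioc 0 t ×ˢ M.K m, φ p.1 p.2 ω ∂(M.N ω)) -
    ∫ p in Ioc 0 t ×ˢ M.K m, φ p.1 p.2 ω ∂((volume : Measure ℝ).prod M.ν)

/-- `J` is the forward integral `∫₀^S ∫ φ(s, z) Ñ(d⁻s, dz)` up to the (deterministic or random)
time `S`: the limit in `L²(P)` of the integrals over the sets `K m`. -/
structure IsForwardIntegralN (M : Market Ω) (φ : ℝ → ℝ → Ω → ℝ) (S : Ω → ℝ) (J : Ω → ℝ) :
    Prop where
  measurable : ∀ m, AEStronglyMeasurable (fun ω => M.truncN φ m (S ω) ω) M.P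
  memLp : MemLp J 2 M.P
  tendsto : Tendsto (fun m => eLpNorm (fun ω => M.truncN φ m (S ω) ω - J ω) 2 M.P) atTop (𝓝 0)

/-- `φ` is a càglàd random field which is forward integrable with respect to `Ñ`: the integrals
over the sets `K m` make sense, and their `L²(P)`-limits exist up to each time `t ∈ [0, T]` and
up to the final trading time `τ`. -/
structure ForwardIntegrableN (M : Market Ω) (φ : ℝ → ℝ → Ω → ℝ) : Prop where
  caglad : ∀ᵐ z ∂M.ν, ∀ᵐ ω ∂M.P, IsCaglad M.T (fun t => φ t z ω)
  integrableOn : ∀ m, ∀ᵐ ω ∂M.P,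
    IntegrableOn (fun p : ℝ × ℝ => φ p.1 p.2 ω) (Ioc 0 M.T ×ˢ M.K m) (M.N ω) ∧
    IntegrableOn (fun p : ℝ × ℝ => φ p.1 p.2 ω) (Ioc 0 M.T ×ˢ M.K m)
      ((volume : Measure ℝ).prod M.ν)
  exists_limit : ∀ t ∈ Icc 0 M.T, ∃ J, M.IsForwardIntegralN φ (fun _ => t) J
  exists_limit_τ : ∃ J, M.IsForwardIntegralN φ (fun ω => M.τ ω) J

open Classical in
/-- The forward integral `∫₀^S ∫ φ(s, z) Ñ(d⁻s, dz)` (`0` if the limit does not exist). -/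
def forwardN (M : Market Ω) (φ : ℝ → ℝ → Ω → ℝ) (S : Ω → ℝ) : Ω → ℝ :=
  if h : ∃ J, M.IsForwardIntegralN φ S J then h.choose else 0

/-! ### The defaultable asset and the standing assumptions -/

/-- The jump `ΔH(t) = H(t) - H(t-)`. -/
def jumpH (M : Market Ω) (t : ℝ) (ω : Ω) : ℝ := M.H ω t - Function.leftLim (M.H ω) t

/-- The price `S₁(t)` of the defaultable asset. -/
def S₁ (M : Market Ω) (t : ℝ) (ω : Ω) : ℝ :=
  M.s₀ * (∏ᶠ (s : ℝ) (_ : s ∈ Ioc 0 t ∧ 0 < M.jumpH s ω), (1 + M.κ s ω * M.jumpH s ω)) *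
    Real.exp ((∫ s in Ioc 0 t, (M.μ s ω - 1 / 2 * M.σ s ω ^ 2))
      + M.forwardW M.σ t ω
      + (∫ s in Ioc 0 t, ∫ z, (Real.log (1 + M.θ s z ω) - M.θ s z ω) ∂M.ν)
      + M.forwardN (fun s z ω => Real.log (1 + M.θ s z ω)) (fun _ => t) ω)

/-- The standing assumptions on the model. -/
structure Standing (M : Market Ω) : Prop where
  prob : IsProbabilityMeasure M.P
  complete : M.P.IsComplete
  T_pos : 0 < M.T
  x₀_pos : 0 < M.x₀
  s₀_pos : 0 < M.s₀
  -- the noises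
  wiener : IsBrownianReal M.W M.P
  ν_zero : M.ν {0} = 0
  ν_sigmaFinite : SigmaFinite M.ν
  ν_sq : ∫⁻ z, ‖z‖ₑ ^ 2 ∂M.ν < ∞
  poisson : IsPoissonRandomMeasure M.N
    (((volume : Measure ℝ).restrict (Ici 0)).prod M.ν) M.P
  indep : IndepFun (fun ω t => M.W t ω) M.N M.P
  K_mono : Monotone M.K
  K_compact : ∀ m, IsCompact (M.K m)
  K_finite : ∀ m, M.ν (M.K m) < ∞
  K_union : ⋃ m, M.K m = {0}ᶜ
  -- the counting process
  H_measurable : ∀ t, Measurable (fun ω => M.H ω t)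
  H_nat : ∀ ω t, ∃ n : ℕ, M.H ω t = n
  H_zero : ∀ ω, ∀ t ≤ 0, M.H ω t = 0
  H_integrable : Integrable (fun ω => M.H ω M.T) M.P
  H_simple : ∀ᵐ ω ∂M.P, ∀ t ∈ Icc 0 M.T, M.jumpH t ω ≤ 1
  no_common_jumps : ∀ᵐ ω ∂M.P, ¬ ∃ t ∈ Icc 0 M.T, ∃ C : Set ℝ, IsCompact C ∧ C ⊆ {0}ᶜ ∧
    0 < M.jumpH t ω ∧ 0 < M.N ω ({t} ×ˢ C)
  -- the information flow: augmented and right-continuous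
  G_augmented : ∀ t s, M.P s = 0 → MeasurableSet[M.G t] s
  G_rightCont : M.G.IsRightContinuous
  -- the predictable intensity of the counting process
  Λ_measurable : Measurable M.Λ
  Λ_predictable : Measurable[M.G.predictable]
    (fun p : ℝ≥0 × Ω => M.Λ p.2 (Ioc 0 (min (p.1 : ℝ) M.T)))
  Λ_compensator : ∀ f : ℝ≥0 × Ω → ℝ≥0∞, Measurable[M.G.predictable] f → ∀ t ∈ Icc 0 M.T,
    ∫⁻ ω, ∫⁻ s in Ioc 0 t, f (s.toNNReal, ω) ∂(M.H ω).measure ∂M.P =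
      ∫⁻ ω, ∫⁻ s in Ioc 0 t, f (s.toNNReal, ω) ∂(M.Λ ω) ∂M.P
  -- the coefficients
  ρ_measurable : Measurable (fun p : ℝ × Ω => M.ρ p.1 p.2)
  μ_measurable : Measurable (fun p : ℝ × Ω => M.μ p.1 p.2)
  σ_measurable : Measurable (fun p : ℝ × Ω => M.σ p.1 p.2)
  κ_measurable : Measurable (fun p : ℝ × Ω => M.κ p.1 p.2)
  θ_measurable : Measurable (fun p : ℝ × ℝ × Ω => M.θ p.1 p.2.1 p.2.2)
  ρ_caglad : ∀ᵐ ω ∂M.P, IsCaglad M.T (fun t => M.ρ t ω)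
  μ_caglad : ∀ᵐ ω ∂M.P, IsCaglad M.T (fun t => M.μ t ω)
  σ_caglad : ∀ᵐ ω ∂M.P, IsCaglad M.T (fun t => M.σ t ω)
  κ_caglad : ∀ᵐ ω ∂M.P, IsCaglad M.T (fun t => M.κ t ω)
  θ_caglad : ∀ᵐ z ∂M.ν, ∀ᵐ ω ∂M.P, IsCaglad M.T (fun t => M.θ t z ω)
  σ_forward : M.ForwardIntegrableW M.σ
  θ_forward : M.ForwardIntegrableN M.θ
  log_θ_forward : M.ForwardIntegrableN (fun s z ω => Real.log (1 + M.θ s z ω))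
  finite : ∫⁻ ω, ((∫⁻ s in Ioc 0 M.T,
      (‖M.μ s ω‖ₑ + ‖M.σ s ω‖ₑ ^ 2 + ∫⁻ z, ‖M.θ s z ω‖ₑ ^ 2 ∂M.ν)) +
      ∫⁻ s in Ioc 0 M.T, ‖M.κ s ω‖ₑ ∂(M.Λ ω)) ∂M.P < ∞
  θ_gt : ∀ᵐ p ∂((volume : Measure ℝ).restrict (Icc 0 M.T)).prod (M.ν.prod M.P),
    -1 < M.θ p.1 p.2.1 p.2.2
  κ_ge : ∀ᵐ p ∂((volume : Measure ℝ).restrict (Icc 0 M.T)).prod M.P, -1 ≤ M.κ p.1 p.2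
  -- the final trading time
  τ_stopping : IsStoppingTime M.G (fun ω => (M.τ ω : WithTop ℝ≥0))
  τ_le : ∀ ω, (M.τ ω : ℝ) ≤ M.T
  τ_le_zero : ∀ᵐ ω ∂M.P, ∀ t ∈ Icc 0 M.T, M.S₁ t ω = 0 → (M.τ ω : ℝ) ≤ t

/-! ### Admissible portfolios and wealth -/

/-- The set of admissible portfolios. "For almost every `z`" in the lower bound on `π θ` means:
outside a `ν`-null set that depends neither on `t` nor on `ω`, so that the Poisson random measure
does not charge it. -/
structure Admissible (M : Market Ω) (π : ℝ → Ω → ℝ) : Prop where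
  caglad : ∀ᵐ ω ∂M.P, IsCaglad M.T (fun t => π t ω)
  adapted : ∀ t : ℝ≥0, (t : ℝ) ≤ M.T → Measurable[M.G t] (π t)
  bound : ∃ ε > 0,
    (∀ᵐ ω ∂M.P, ∀ t ∈ Icc 0 M.T, -1 + ε < π t ω * M.κ t ω) ∧
    ∃ A : Set ℝ, MeasurableSet A ∧ M.ν Aᶜ = 0 ∧
      ∀ᵐ ω ∂M.P, ∀ t ∈ Icc 0 M.T, ∀ z ∈ A, -1 + ε < π t ω * M.θ t z ω
  finite : ∫⁻ ω, (∫⁻ s in Ioc 0 M.T,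
    (‖M.μ s ω - M.ρ s ω‖ₑ * ‖π s ω‖ₑ + ‖M.σ s ω‖ₑ ^ 2 * ‖π s ω‖ₑ ^ 2)) ∂M.P < ∞
  finite_θ : ∫⁻ ω, (∫⁻ s in Ioc 0 M.T, ∫⁻ z, ‖M.θ s z ω * π s ω‖ₑ ^ 2 ∂M.ν) ∂M.P < ∞
  caglad_σ : ∀ᵐ ω ∂M.P, IsCaglad M.T (fun t => π t ω * M.σ t ω)
  forward_σ : M.ForwardIntegrableW (fun t ω => π t ω * M.σ t ω)
  forward_θ : M.ForwardIntegrableN (fun t z ω => π t ω * M.θ t z ω)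
  forward_log : M.ForwardIntegrableN (fun t z ω => Real.log (1 + π t ω * M.θ t z ω))
  forward_div : M.ForwardIntegrableN
    (fun t z ω => π t ω * M.θ t z ω / (1 + π t ω * M.θ t z ω))

/-- The process `β` is bounded on `[0, T]`. -/
def IsBoundedOnHorizon (M : Market Ω) (β : ℝ → Ω → ℝ) : Prop :=
  ∃ C : ℝ, ∀ᵐ ω ∂M.P, ∀ t ∈ Icc 0 M.T, |β t ω| ≤ C

/-- The wealth `X̃_π(τ)` at the final trading time. -/
def wealthτ (M : Market Ω) (π : ℝ → Ω → ℝ) (ω : Ω) : ℝ :=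
  M.x₀ * Real.exp (
    (∫ s in Ioc 0 (M.τ ω : ℝ),
      (M.ρ s ω + (M.μ s ω - M.ρ s ω) * π s ω - 1 / 2 * M.σ s ω ^ 2 * π s ω ^ 2))
    + (∫ s in Ioc 0 (M.τ ω : ℝ),
        ∫ z, (Real.log (1 + π s ω * M.θ s z ω) - π s ω * M.θ s z ω) ∂M.ν)
    + M.forwardW (fun s ω => π s ω * M.σ s ω) (M.τ ω) ω
    + M.forwardN (fun s z ω => Real.log (1 + π s ω * M.θ s z ω)) (fun ω => M.τ ω) ω
    + ∫ s in Ioc 0 (M.τ ω : ℝ), Real.log (1 + M.κ s ω * π s ω) ∂(M.H ω).measure)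

/-- The final wealth `X_π(T) = X̃_π(τ) exp(∫_τ^T ρ(s) ds)`. -/
def X (M : Market Ω) (π : ℝ → Ω → ℝ) (ω : Ω) : ℝ :=
  M.wealthτ π ω * Real.exp (∫ s in Ioc (M.τ ω : ℝ) M.T, M.ρ s ω)

/-- The random field `β θ / (1 + (π + y β) θ)`. -/
def ψField (M : Market Ω) (y : ℝ) (β π : ℝ → Ω → ℝ) (s z : ℝ) (ω : Ω) : ℝ :=
  β s ω * M.θ s z ω / (1 + (π s ω + y * β s ω) * M.θ s z ω)

/-- The random variable `Ψ(y, β, π)`. -/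
def Ψ (M : Market Ω) (y : ℝ) (β π : ℝ → Ω → ℝ) (ω : Ω) : ℝ :=
  (∫ s in Ioc 0 (M.τ ω : ℝ),
      β s ω * (M.μ s ω - M.ρ s ω - (π s ω + y * β s ω) * M.σ s ω ^ 2))
    + (∫ s in Ioc 0 (M.τ ω : ℝ), ∫ z, (M.ψField y β π s z ω - β s ω * M.θ s z ω) ∂M.ν)
    + M.forwardW (fun s ω => β s ω * M.σ s ω) (M.τ ω) ω
    + M.forwardN (M.ψField y β π) (fun ω => M.τ ω) ω
    + ∫ s in Ioc 0 (M.τ ω : ℝ),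
        β s ω * M.κ s ω / (1 + M.κ s ω * (π s ω + y * β s ω)) ∂(M.H ω).measure

/-- The random variable `Ψ_y(y, β, π)`, the derivative of `Ψ` with respect to `y`. Its integrand
with respect to `N` is a square, and the integral is taken path by path. -/
def Ψy (M : Market Ω) (y : ℝ) (β π : ℝ → Ω → ℝ) (ω : Ω) : ℝ :=
  -(∫ s in Ioc 0 (M.τ ω : ℝ), β s ω ^ 2 * M.σ s ω ^ 2)
    - (∫ p in Ioc 0 (M.τ ω : ℝ) ×ˢ ({0}ᶜ : Set ℝ), M.ψField y β π p.1 p.2 ω ^ 2 ∂(M.N ω))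
    - ∫ s in Ioc 0 (M.τ ω : ℝ),
        β s ω ^ 2 * M.κ s ω ^ 2 / (1 + (π s ω + y * β s ω) * M.κ s ω) ^ 2 ∂(M.H ω).measure

/-! ### The two assumptions on the utility function and the portfolio -/

/-- Assumption `A_u.i.` for the portfolio `π`, with radii `δ β` (for bounded admissible `β`). The
perturbed wealth and `Ψ` have to be well defined for `|y| < δ β`: the perturbed portfolio is
admissible and the integrand of the forward integral in `Ψ` is forward integrable. -/
structure AssumptionUI (M : Market Ω) (U : ℝ → ℝ) (π : ℝ → Ω → ℝ)
    (δ : (ℝ → Ω → ℝ) → ℝ) : Prop where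
  integrable : Integrable (fun ω => U (M.X π ω)) M.P
  integrable_deriv : Integrable (fun ω => deriv U (M.X π ω) * M.X π ω) M.P
  pos : 0 < ∫ ω, deriv U (M.X π ω) * M.X π ω ∂M.P
  perturbation : ∀ β, M.Admissible β → M.IsBoundedOnHorizon β →
    0 < δ β ∧
    (∀ y ∈ Ioo (-δ β) (δ β), M.Admissible (π + y • β)) ∧
    (∀ y ∈ Ioo (-δ β) (δ β), M.ForwardIntegrableN (M.ψField y β π)) ∧
    UniformIntegrable
      (fun (y : Ioo (-δ β) (δ β)) ω =>
        deriv U (M.X (π + (y : ℝ) • β) ω) * M.X (π + (y : ℝ) • β) ω * |M.Ψ y β π ω|) 1 M.P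

/-- Assumption `A_{d²}` for the portfolio `π`, with radii `δ β` (for bounded admissible `β`). The
integral with respect to `N` in `Ψ_y` has to be finite for `|y| < δ β`. -/
structure AssumptionD2 (M : Market Ω) (U : ℝ → ℝ) (π : ℝ → Ω → ℝ)
    (δ : (ℝ → Ω → ℝ) → ℝ) : Prop where
  differentiable : DifferentiableOn ℝ U (Ioi 0)
  differentiable_deriv : DifferentiableOn ℝ (deriv U) (Ioi 0)
  strictMono : StrictMonoOn U (Ioi 0)
  concave : ConcaveOn ℝ (Ioi 0) U
  perturbation : ∀ β, M.Admissible β → M.IsBoundedOnHorizon β →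
    0 < δ β ∧
    (∀ y ∈ Ioo (-δ β) (δ β), ∀ᵐ ω ∂M.P,
      IntegrableOn (fun p : ℝ × ℝ => M.ψField y β π p.1 p.2 ω ^ 2)
        (Ioc 0 (M.τ ω : ℝ) ×ˢ ({0}ᶜ : Set ℝ)) (M.N ω)) ∧
    UniformIntegrable
      (fun (y : Ioo (-δ β) (δ β)) ω =>
        deriv (deriv U) (M.X (π + (y : ℝ) • β) ω) * M.X (π + (y : ℝ) • β) ω ^ 2 *
            M.Ψ y β π ω ^ 2 +
          deriv U (M.X (π + (y : ℝ) • β) ω) * M.X (π + (y : ℝ) • β) ω *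
            (M.Ψ y β π ω ^ 2 + M.Ψy y β π ω)) 1 M.P

end Market

end

/-!
The proof does not differentiate the wealth in `y`: each forward integral is a limit in `L¹` or
`L²`, determined only up to a null set depending on `y`. It rests instead on a supergradient
inequality between two fixed portfolios. For `y` and `y'` in `(-δ, δ)`, almost surely,
`log X_{π+y'β} ≤ log X_{π+yβ} + (y' - y) Ψ(y, β, π)` (`Market.log_X_le`). The inequality is checked
term by term.

* The drift is a concave quadratic in the portfolio (`Market.drift_part_le`).
* The forward integral with respect to `W` is linear by uniqueness of limits
  (`Market.forwardW_add_const_mul`); continuity of the paths allows evaluation at `τ`.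
* The default term integrates, against the positive measure `dH`, the tangent inequality for
  `x ↦ log (1 + x)` (`Market.default_part_le`).
* In the jump term the field `D = log (1 + π'θ) - log (1 + πθ) - (y' - y) ψ` is nonpositive, but it
  is integrated against the signed `Ñ`. The remaining `ν(dz) ds`-integrals add up to the integral of
  `D`, and for each truncation set `K m` the part of this integral over `K m` cancels the
  compensator, so that only nonpositive contributions are left (`Market.jump_part_le`).

The condition `x U'' + U' ≤ 0` says that `u ↦ U (exp u)` is concave, and it is nondecreasing, so
the inequality passes to `U (X_{π+yβ})`, with supergradient `g y = U'(X) X Ψ(y, β, π)`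
(`comp_le_of_log_le`). The variables `g y` are integrable by uniform integrability. The inequality
from `0` to `y` and the one from `y` to `0` bound the increment of `U (X_{π+yβ})` by
`|y| (|g 0| + |g y|)`, whence integrability; the supergradients at a convex combination give
concavity.

For integrability, the final wealth has to be measurable. Adapted càglàd processes have jointly
measurable versions (`exists_jointly_measurable_of_leftContinuous`), which makes integrals up to
the random time `τ` measurable.
-/

/-! ### Càglàd paths and jointly measurable versions -/

namespace IsCaglad

variable {T : ℝ} {f g : ℝ → ℝ}

theorem const (c : ℝ) : IsCaglad T (fun _ => c) :=
  ⟨fun _ _ => tendsto_const_nhds, fun _ _ => ⟨c, tendsto_const_nhds⟩⟩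

theorem add (hf : IsCaglad T f) (hg : IsCaglad T g) : IsCaglad T (fun t => f t + g t) := by
  refine ⟨fun t ht => (hf.1 t ht).add (hg.1 t ht), fun t ht => ?_⟩
  obtain ⟨a, ha⟩ := hf.2 t ht
  obtain ⟨b, hb⟩ := hg.2 t ht
  exact ⟨a + b, ha.add hb⟩

theorem mul (hf : IsCaglad T f) (hg : IsCaglad T g) : IsCaglad T (fun t => f t * g t) := by
  refine ⟨fun t ht => (hf.1 t ht).mul (hg.1 t ht), fun t ht => ?_⟩
  obtain ⟨a, ha⟩ := hf.2 t ht
  obtain ⟨b, hb⟩ := hg.2 t ht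
  exact ⟨a * b, ha.mul hb⟩

theorem sub (hf : IsCaglad T f) (hg : IsCaglad T g) : IsCaglad T (fun t => f t - g t) := by
  simpa [sub_eq_add_neg] using hf.add ((const (-1)).mul hg)

/-- Closedness of `s` keeps the right limits of `f` in the domain of continuity of `φ`. -/
theorem comp_continuousOn {s : Set ℝ} {φ : ℝ → ℝ} (hf : IsCaglad T f) (hs : IsClosed s)
    (hφ : ContinuousOn φ s) (h : ∀ t ∈ Icc 0 T, f t ∈ s) : IsCaglad T (fun t => φ (f t)) := by
  refine ⟨fun t ht => ?_, fun t ht => ?_⟩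
  · have h1 : Tendsto f (𝓝[<] t) (𝓝[s] (f t)) := by
      refine tendsto_nhdsWithin_iff.2 ⟨hf.1 t ht, ?_⟩
      filter_upwards [Ioo_mem_nhdsLT ht.1] with u hu
      exact h u ⟨hu.1.le, hu.2.le.trans ht.2⟩
    exact (hφ (f t) (h t ⟨ht.1.le, ht.2⟩)).tendsto.comp h1
  · obtain ⟨l, hl⟩ := hf.2 t ht
    have hev : ∀ᶠ u in 𝓝[>] t, f u ∈ s := by
      filter_upwards [Ioo_mem_nhdsGT ht.2] with u hu
      exact h u ⟨ht.1.trans hu.1.le, hu.2.le⟩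
    have hls : l ∈ s := hs.mem_of_tendsto hl hev
    exact ⟨φ l, (hφ l hls).tendsto.comp (tendsto_nhdsWithin_iff.2 ⟨hl, hev⟩)⟩

theorem log {ε : ℝ} (hε : 0 < ε) (hf : IsCaglad T f) (h : ∀ t ∈ Icc 0 T, ε ≤ f t) :
    IsCaglad T (fun t => Real.log (f t)) :=
  hf.comp_continuousOn isClosed_Ici
    (Real.continuousOn_log.mono fun x (hx : ε ≤ x) => (hε.trans_le hx).ne') h

theorem inv {ε : ℝ} (hε : 0 < ε) (hf : IsCaglad T f) (h : ∀ t ∈ Icc 0 T, ε ≤ f t) :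
    IsCaglad T (fun t => (f t)⁻¹) :=
  hf.comp_continuousOn isClosed_Ici
    (continuousOn_inv₀.mono fun x (hx : ε ≤ x) => (hε.trans_le hx).ne') h

theorem _root_.ContinuousOn.isCaglad (hf : ContinuousOn f (Icc 0 T)) : IsCaglad T f := by
  refine ⟨fun t ht => ?_, fun t ht => ⟨f t, ?_⟩⟩
  · refine (hf t ⟨ht.1.le, ht.2⟩).tendsto.mono_left ?_
    rw [← nhdsWithin_Ioo_eq_nhdsLT ht.1]
    exact nhdsWithin_mono _ fun u hu => ⟨hu.1.le, hu.2.le.trans ht.2⟩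
  · refine (hf t ⟨ht.1, ht.2.le⟩).tendsto.mono_left ?_
    rw [← nhdsWithin_Ioo_eq_nhdsGT ht.2]
    exact nhdsWithin_mono _ fun u hu => ⟨ht.1.trans hu.1.le, hu.2.le⟩

/-- By compactness: each point of `[0, T]` has a neighbourhood on which `f` is bounded. -/
theorem exists_bound (hf : IsCaglad T f) : ∃ C, ∀ t ∈ Ioc 0 T, |f t| ≤ C := by
  have key : ∃ C, ∀ t ∈ Icc (0 : ℝ) T, t ∈ Ioc 0 T → |f t| ≤ C := by
    refine isCompact_Icc.induction_on (p := fun s => ∃ C, ∀ t ∈ s, t ∈ Ioc 0 T → |f t| ≤ C)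
      ⟨0, by simp⟩ (fun s t hst ⟨C, hC⟩ => ⟨C, fun u hu => hC u (hst hu)⟩) ?_ ?_
    · rintro s t ⟨C, hC⟩ ⟨D, hD⟩
      refine ⟨max C D, fun u hu hu' => ?_⟩
      rcases hu with hu | hu
      · exact (hC u hu hu').trans (le_max_left _ _)
      · exact (hD u hu hu').trans (le_max_right _ _)
    · intro t ht
      have hl : ∃ C, ∀ᶠ u in 𝓝[<] t, u ∈ Ioc 0 T → |f u| ≤ C := by
        rcases ht.1.eq_or_lt with h0 | h0
        · refine ⟨0, ?_⟩
          filter_upwards [self_mem_nhdsWithin] with u hu hu'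
          exact absurd hu'.1 (by rw [h0]; exact not_lt.2 (le_of_lt hu))
        · refine ⟨|f t| + 1, ?_⟩
          filter_upwards [(hf.1 t ⟨h0, ht.2⟩).abs.eventually_le_const (lt_add_one _)] with u hu _
          exact hu
      have hr : ∃ C, ∀ᶠ u in 𝓝[>] t, u ∈ Ioc 0 T → |f u| ≤ C := by
        rcases ht.2.eq_or_lt with h0 | h0
        · refine ⟨0, ?_⟩
          filter_upwards [self_mem_nhdsWithin] with u hu hu'
          exact absurd hu'.2 (by rw [← h0]; exact not_le.2 hu)
        · obtain ⟨l, hl⟩ := hf.2 t ⟨ht.1, h0⟩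
          refine ⟨|l| + 1, ?_⟩
          filter_upwards [hl.abs.eventually_le_const (lt_add_one _)] with u hu _
          exact hu
      obtain ⟨C, hC⟩ := hl
      obtain ⟨D, hD⟩ := hr
      refine ⟨_, mem_nhdsWithin_of_mem_nhds (?_ : {u | u ∈ Ioc 0 T →
        |f u| ≤ max (max C D) |f t|} ∈ 𝓝 t), max (max C D) |f t|, fun u hu => hu⟩
      rw [← nhdsNE_sup_pure, punctured_nhds_eq_nhdsWithin_sup_nhdsWithin]
      refine mem_sup.2 ⟨mem_sup.2 ⟨?_, ?_⟩, ?_⟩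
      · filter_upwards [hC] with u hu h
        exact (hu h).trans ((le_max_left _ _).trans (le_max_left _ _))
      · filter_upwards [hD] with u hu h
        exact (hu h).trans ((le_max_right _ _).trans (le_max_left _ _))
      · exact fun _ => le_max_right _ _
  obtain ⟨C, hC⟩ := key
  exact ⟨C, fun t ht => hC t ⟨ht.1.le, ht.2⟩ ht⟩

end IsCaglad

/-- A process with measurable marginals and left-continuous paths has a jointly measurable version
on `(0, T]`: the limit of the processes frozen at the last time strictly before `t` in a grid. -/
theorem exists_jointly_measurable_of_leftContinuous {Ω : Type*} [MeasurableSpace Ω]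
    {P : Measure Ω} {T : ℝ} {f : ℝ → Ω → ℝ} (hf : ∀ t ∈ Icc 0 T, AEMeasurable (f t) P)
    (hc : ∀ᵐ ω ∂P, ∀ t ∈ Ioc 0 T, Tendsto (fun s => f s ω) (𝓝[<] t) (𝓝 (f t ω))) :
    ∃ F : ℝ → Ω → ℝ, Measurable (fun p : ℝ × Ω => F p.1 p.2) ∧
      ∀ᵐ ω ∂P, ∀ t ∈ Ioc 0 T, F t ω = f t ω := by
  classical
  let grid : ℕ → ℝ → ℤ := fun n t => ⌈((n : ℝ) + 1) * t⌉ - 1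
  let g : ℕ → ℤ → Ω → ℝ := fun n k =>
    if h : ((k : ℝ) / (n + 1)) ∈ Icc 0 T then (hf _ h).mk else 0
  have hg : ∀ n k, Measurable (g n k) := by
    intro n k
    by_cases h : ((k : ℝ) / (n + 1)) ∈ Icc 0 T
    · simp only [g, h, dif_pos]; exact (hf _ h).measurable_mk
    · simp only [g, h, dif_neg, not_false_iff]; exact measurable_zero
  have hgf : ∀ᵐ ω ∂P, ∀ (n : ℕ) (k : ℤ), ((k : ℝ) / (n + 1)) ∈ Icc 0 T →
      g n k ω = f (k / (n + 1)) ω := by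
    refine ae_all_iff.2 fun (n : ℕ) => ae_all_iff.2 fun (k : ℤ) => ?_
    by_cases h : ((k : ℝ) / (n + 1)) ∈ Icc 0 T
    · filter_upwards [(hf _ h).ae_eq_mk] with ω hω _
      simp only [g, h, dif_pos]; exact hω.symm
    · exact Eventually.of_forall fun ω h' => absurd h' h
  refine ⟨fun t ω => limsup (fun n => g n (grid n t) ω) atTop, ?_, ?_⟩
  · refine Measurable.limsup fun n => ?_
    have h1 : Measurable (fun q : ℤ × Ω => g n q.1 q.2) :=
      measurable_from_prod_countable_right fun k => hg n k
    have h2 : Measurable (grid n) :=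
      (Int.measurable_ceil.comp (measurable_const.mul measurable_id)).sub_const 1
    exact h1.comp ((h2.comp measurable_fst).prodMk measurable_snd)
  · filter_upwards [hgf, hc] with ω h1 h2 t ht
    have hpos : ∀ n : ℕ, (0 : ℝ) < (n : ℝ) + 1 := fun n => by positivity
    have hlt : ∀ n, (grid n t : ℝ) / (n + 1) < t := fun n => by
      rw [div_lt_iff₀ (hpos n)]
      have := Int.ceil_lt_add_one (((n : ℝ) + 1) * t)
      simp only [grid]; push_cast; linarith
    have hge : ∀ n : ℕ, t - 1 / ((n : ℝ) + 1) ≤ (grid n t : ℝ) / (n + 1) := fun n => by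
      rw [le_div_iff₀ (hpos n), sub_mul, one_div, inv_mul_cancel₀ (hpos n).ne']
      have := Int.le_ceil (((n : ℝ) + 1) * t)
      simp only [grid]; push_cast; linarith
    have h0 : ∀ n, (0 : ℝ) ≤ (grid n t : ℝ) / (n + 1) := fun n => by
      refine div_nonneg ?_ (hpos n).le
      have : 0 < ⌈((n : ℝ) + 1) * t⌉ := Int.ceil_pos.2 (mul_pos (hpos n) ht.1)
      exact_mod_cast (by simp only [grid]; omega : (0 : ℤ) ≤ grid n t)
    have hlim : Tendsto (fun n => (grid n t : ℝ) / (n + 1)) atTop (𝓝[<] t) := by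
      refine tendsto_nhdsWithin_iff.2 ⟨?_, Eventually.of_forall hlt⟩
      refine tendsto_of_tendsto_of_tendsto_of_le_of_le ?_ tendsto_const_nhds hge fun n => (hlt n).le
      simpa using tendsto_const_nhds.sub (tendsto_one_div_add_atTop_nhds_zero_nat (𝕜 := ℝ))
    refine Tendsto.limsup_eq (((h2 t ht).comp hlim).congr fun n => ?_)
    exact (h1 n _ ⟨h0 n, (hlt n).le.trans ht.2⟩).symm

namespace IsCaglad

variable {T : ℝ} {f : ℝ → ℝ}

theorem aestronglyMeasurable (hf : IsCaglad T f) (m : Measure ℝ) :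
    AEStronglyMeasurable f (m.restrict (Ioc 0 T)) := by
  obtain ⟨F, hF, h⟩ := exists_jointly_measurable_of_leftContinuous (P := Measure.dirac ())
    (T := T) (f := fun t _ => f t) (fun _ _ => aemeasurable_const)
    (Eventually.of_forall fun _ => hf.1)
  have h' : ∀ t ∈ Ioc 0 T, F t () = f t := by simpa using h
  refine ⟨fun t => F t (), (hF.comp (measurable_id.prodMk measurable_const)).stronglyMeasurable, ?_⟩
  filter_upwards [ae_restrict_mem measurableSet_Ioc] with t ht
  exact (h' t ht).symm

theorem integrableOn (hf : IsCaglad T f) {m : Measure ℝ} (hm : m (Ioc 0 T) ≠ ∞) :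
    IntegrableOn f (Ioc 0 T) m := by
  obtain ⟨C, hC⟩ := hf.exists_bound
  have : IsFiniteMeasure (m.restrict (Ioc 0 T)) := ⟨by simpa using hm.lt_top⟩
  refine Integrable.of_bound (hf.aestronglyMeasurable m) C ?_
  filter_upwards [ae_restrict_mem measurableSet_Ioc] with t ht
  exact hC t ht

end IsCaglad

/-- On `(0, T]`, the process `f` coincides, outside a null set of paths, with a jointly measurable
process. -/
def HasMeasurableVersion {Ω : Type*} [MeasurableSpace Ω] (P : Measure Ω) (T : ℝ)
    (f : ℝ → Ω → ℝ) : Prop :=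
  ∃ F : ℝ → Ω → ℝ, Measurable (fun p : ℝ × Ω => F p.1 p.2) ∧
    ∀ᵐ ω ∂P, ∀ t ∈ Ioc 0 T, F t ω = f t ω

namespace HasMeasurableVersion

variable {Ω : Type*} [MeasurableSpace Ω] {P : Measure Ω} {T : ℝ} {f g : ℝ → Ω → ℝ}

theorem of_measurable (hf : Measurable (fun p : ℝ × Ω => f p.1 p.2)) :
    HasMeasurableVersion P T f :=
  ⟨f, hf, Eventually.of_forall fun _ _ _ => rfl⟩

theorem comp₂ {φ : ℝ → ℝ → ℝ} (hφ : Measurable (fun p : ℝ × ℝ => φ p.1 p.2))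
    (hf : HasMeasurableVersion P T f) (hg : HasMeasurableVersion P T g) :
    HasMeasurableVersion P T (fun t ω => φ (f t ω) (g t ω)) := by
  obtain ⟨F, hF, hFf⟩ := hf
  obtain ⟨G, hG, hGg⟩ := hg
  refine ⟨fun t ω => φ (F t ω) (G t ω), hφ.comp (hF.prodMk hG), ?_⟩
  filter_upwards [hFf, hGg] with ω h1 h2 t ht
  rw [h1 t ht, h2 t ht]

theorem add (hf : HasMeasurableVersion P T f) (hg : HasMeasurableVersion P T g) :
    HasMeasurableVersion P T (fun t ω => f t ω + g t ω) :=
  comp₂ (φ := fun x y => x + y) (by fun_prop) hf hg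

theorem mul (hf : HasMeasurableVersion P T f) (hg : HasMeasurableVersion P T g) :
    HasMeasurableVersion P T (fun t ω => f t ω * g t ω) :=
  comp₂ (φ := fun x y => x * y) (by fun_prop) hf hg

/-- Evaluation at a random time, possibly zero. -/
theorem aemeasurable_eval (hf : HasMeasurableVersion P T f) (h0 : AEMeasurable (f 0) P)
    {τ : Ω → ℝ} (hτ : Measurable τ) (hτ0 : ∀ ω, 0 ≤ τ ω) (hτT : ∀ ω, τ ω ≤ T) :
    AEMeasurable (fun ω => f (τ ω) ω) P := by
  obtain ⟨F, hF, h⟩ := hf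
  refine ⟨fun ω => if τ ω = 0 then h0.mk _ ω else F (τ ω) ω,
    Measurable.ite (hτ (measurableSet_singleton 0)) h0.measurable_mk
      (hF.comp (hτ.prodMk measurable_id)), ?_⟩
  filter_upwards [h, h0.ae_eq_mk] with ω h1 h2
  by_cases hω : τ ω = 0
  · simp [hω, h2]
  · simp [hω, h1 (τ ω) ⟨lt_of_le_of_ne (hτ0 ω) (Ne.symm hω), hτT ω⟩]

/-- Integration up to a random time against a random measure. -/
theorem aemeasurable_setIntegral (hf : HasMeasurableVersion P T f) (m : Kernel Ω ℝ)
    [IsSFiniteKernel m] {S τ : Ω → ℝ} (hS : Measurable S) (hτ : Measurable τ)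
    (hS0 : ∀ ω, 0 ≤ S ω) (hτT : ∀ ω, τ ω ≤ T) :
    AEMeasurable (fun ω => ∫ s in Ioc (S ω) (τ ω), f s ω ∂(m ω)) P := by
  obtain ⟨F, hF, h⟩ := hf
  have hset : MeasurableSet {p : Ω × ℝ | p.2 ∈ Ioc (S p.1) (τ p.1)} :=
    (measurableSet_lt (hS.comp measurable_fst) measurable_snd).inter
      (measurableSet_le measurable_snd (hτ.comp measurable_fst))
  have hG : StronglyMeasurable
      ({p : Ω × ℝ | p.2 ∈ Ioc (S p.1) (τ p.1)}.indicator fun p => F p.2 p.1) :=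
    ((hF.comp measurable_swap).indicator hset).stronglyMeasurable
  refine ⟨_, (hG.integral_kernel_prod_right' (κ := m)).measurable, ?_⟩
  filter_upwards [h] with ω hω
  rw [← integral_indicator measurableSet_Ioc]
  congr 1
  ext s
  by_cases hs : s ∈ Ioc (S ω) (τ ω)
  · have hs' : (ω, s) ∈ {p : Ω × ℝ | p.2 ∈ Ioc (S p.1) (τ p.1)} := hs
    rw [indicator_of_mem hs, indicator_of_mem hs',
      hω s ⟨(hS0 ω).trans_lt hs.1, hs.2.trans (hτT ω)⟩]
  · have hs' : (ω, s) ∉ {p : Ω × ℝ | p.2 ∈ Ioc (S p.1) (τ p.1)} := hs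
    rw [indicator_of_notMem hs, indicator_of_notMem hs']

end HasMeasurableVersion

/-! ### Forward integrals with respect to the Wiener process -/

namespace Market

variable {Ω : Type*} [MeasurableSpace Ω] {M : Market Ω}

theorem ForwardIntegrableW.spec {φ : ℝ → Ω → ℝ} (h : M.ForwardIntegrableW φ) :
    M.IsForwardIntegralW φ (M.forwardW φ) := by
  rw [forwardW, dif_pos h]; exact h.choose_spec

/-- Measurability of the approximations makes `∫⁻` subadditive on their distances to the limit. -/
theorem aemeasurable_approxW (hM : M.Standing) {φ : ℝ → Ω → ℝ}
    (hφ : HasMeasurableVersion M.P M.T φ) (ε : ℝ) {t : ℝ} (ht : t ∈ Icc 0 M.T) :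
    AEMeasurable (M.approxW φ ε t) M.P := by
  have hW : ∀ a : ℝ, HasMeasurableVersion M.P M.T (fun s ω => M.W (s + a).toNNReal ω) := by
    intro a
    refine exists_jointly_measurable_of_leftContinuous
      (fun s _ => hM.wiener.aemeasurable _) ?_
    filter_upwards [hM.wiener.cont] with ω hω s _
    exact ((hω.comp (continuous_real_toNNReal.comp (continuous_id.add continuous_const))).tendsto
      s).mono_left nhdsWithin_le_nhds
  have h0 : HasMeasurableVersion M.P M.T (fun s ω => M.W s.toNNReal ω) := by simpa using hW 0
  have h1 : HasMeasurableVersion M.P M.T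
      (fun s ω => φ s ω * ((M.W (s + ε).toNNReal ω - M.W s.toNNReal ω) / ε)) :=
    hφ.mul (HasMeasurableVersion.comp₂ (φ := fun x y => (x - y) / ε) (by fun_prop) (hW ε) h0)
  exact h1.aemeasurable_setIntegral (Kernel.const Ω volume) (S := fun _ => 0)
    (τ := fun _ => t) measurable_const measurable_const (fun _ => le_rfl) (fun _ => ht.2)

theorem approxW_add_const_mul {ω : Ω} (hω : Continuous fun t => M.W t ω) {φ ψ : ℝ → Ω → ℝ}
    (hφ : IsCaglad M.T fun t => φ t ω) (hψ : IsCaglad M.T fun t => ψ t ω) (c ε : ℝ) {t : ℝ}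
    (ht : t ∈ Icc 0 M.T) :
    M.approxW (fun s ω => φ s ω + c * ψ s ω) ε t ω =
      M.approxW φ ε t ω + c * M.approxW ψ ε t ω := by
  have hW : IsCaglad M.T fun s => (M.W (s + ε).toNNReal ω - M.W s.toNNReal ω) / ε := by
    refine ContinuousOn.isCaglad (Continuous.continuousOn ?_)
    exact ((hω.comp (continuous_real_toNNReal.comp (continuous_id.add continuous_const))).sub
      (hω.comp continuous_real_toNNReal)).div_const ε
  have hi : ∀ {f : ℝ → ℝ}, IsCaglad M.T f → IntegrableOn f (Ioc 0 t) := fun hf =>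
    (hf.integrableOn (by simp)).mono_set (Ioc_subset_Ioc_right ht.2)
  simp only [approxW]
  rw [← integral_const_mul, ← integral_add (hi (hφ.mul hW)) ((hi (hψ.mul hW)).const_mul c)]
  congr 1
  ext s
  ring

/-- The forward integral with respect to `W` is linear, simultaneously at all times. -/
theorem forwardW_add_const_mul (hM : M.Standing) {φ ψ : ℝ → Ω → ℝ} (c : ℝ)
    (hφm : HasMeasurableVersion M.P M.T φ) (hψm : HasMeasurableVersion M.P M.T ψ)
    (hφc : ∀ᵐ ω ∂M.P, IsCaglad M.T fun t => φ t ω)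
    (hψc : ∀ᵐ ω ∂M.P, IsCaglad M.T fun t => ψ t ω)
    (hφ : M.ForwardIntegrableW φ) (hψ : M.ForwardIntegrableW ψ)
    (hφψ : M.ForwardIntegrableW fun s ω => φ s ω + c * ψ s ω) :
    ∀ᵐ ω ∂M.P, ∀ t ∈ Icc 0 M.T, M.forwardW (fun s ω => φ s ω + c * ψ s ω) t ω =
      M.forwardW φ t ω + c * M.forwardW ψ t ω := by
  set I := M.forwardW φ
  set J := M.forwardW ψ
  set L := M.forwardW fun s ω => φ s ω + c * ψ s ω
  have hI : M.IsForwardIntegralW φ I := hφ.spec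
  have hJ : M.IsForwardIntegralW ψ J := hψ.spec
  have hL : M.IsForwardIntegralW _ L := hφψ.spec
  -- at a fixed time, both sides are the same `L¹`-limit
  have hfix : ∀ t ∈ Icc 0 M.T, ∀ᵐ ω ∂M.P, L t ω = I t ω + c * J t ω := by
    intro t ht
    have hsup : ∀ {χ K : ℝ → Ω → ℝ}, M.IsForwardIntegralW χ K → Tendsto
        (fun ε : ℝ => ∫⁻ ω, ‖M.approxW χ ε t ω - K t ω‖ₑ ∂M.P) (𝓝[>] 0) (𝓝 0) := by
      intro χ K hK
      refine tendsto_of_tendsto_of_tendsto_of_le_of_le tendsto_const_nhds hK.tendsto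
        (fun _ => zero_le) fun ε => lintegral_mono fun ω => ?_
      exact le_iSup₂ (f := fun t _ => ‖M.approxW χ ε t ω - K t ω‖ₑ) t ht
    have hz : ∫⁻ ω, ‖L t ω - (I t ω + c * J t ω)‖ₑ ∂M.P = 0 := by
      refine le_antisymm (ge_of_tendsto (x := 𝓝[>] (0 : ℝ)) (f := fun ε =>
          (∫⁻ ω, ‖M.approxW (fun s ω => φ s ω + c * ψ s ω) ε t ω - L t ω‖ₑ ∂M.P) +
          ((∫⁻ ω, ‖M.approxW φ ε t ω - I t ω‖ₑ ∂M.P) +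
            ‖c‖ₑ * ∫⁻ ω, ‖M.approxW ψ ε t ω - J t ω‖ₑ ∂M.P)) ?_ ?_) zero_le
      · simpa using (hsup hL).add ((hsup hI).add
          (ENNReal.Tendsto.const_mul (a := ‖c‖ₑ) (hsup hJ) (Or.inr (by simp))))
      · refine Eventually.of_forall fun ε => ?_
        have hmI : AEMeasurable (fun ω => ‖M.approxW φ ε t ω - I t ω‖ₑ) M.P :=
          ((aemeasurable_approxW hM hφm ε ht).sub (hI.measurable t ht).aemeasurable).enorm
        have hmJ : AEMeasurable (fun ω => ‖M.approxW ψ ε t ω - J t ω‖ₑ) M.P :=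
          ((aemeasurable_approxW hM hψm ε ht).sub (hJ.measurable t ht).aemeasurable).enorm
        have hmS : AEMeasurable (fun ω => ‖M.approxW φ ε t ω - I t ω‖ₑ +
            ‖c‖ₑ * ‖M.approxW ψ ε t ω - J t ω‖ₑ) M.P := hmI.add (hmJ.const_mul _)
        rw [← lintegral_const_mul'' _ hmJ, ← lintegral_add_left' hmI,
          ← lintegral_add_right' _ hmS]
        refine lintegral_mono_ae ?_
        filter_upwards [hM.wiener.cont, hφc, hψc] with ω hω h1 h2
        have e := approxW_add_const_mul (M := M) hω h1 h2 c ε ht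
        rw [e, ← enorm_mul]
        refine le_trans ?_ (add_le_add_right (enorm_add_le _ _) _)
        rw [← enorm_neg (L t ω - _)]
        refine le_trans (le_of_eq ?_) (enorm_sub_le)
        congr 1
        ring
    have hm : AEMeasurable (fun ω => ‖L t ω - (I t ω + c * J t ω)‖ₑ) M.P :=
      ((hL.measurable t ht).aemeasurable.sub
        ((hI.measurable t ht).aemeasurable.add
          ((hJ.measurable t ht).aemeasurable.const_mul c))).enorm
    filter_upwards [(lintegral_eq_zero_iff' hm).1 hz] with ω hω
    exact sub_eq_zero.1 (enorm_eq_zero.1 hω)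
  -- the exceptional set can be chosen independent of time, by continuity of the paths
  obtain ⟨D, hDc, hDd⟩ := TopologicalSpace.exists_countable_dense (Icc (0 : ℝ) M.T)
  have hD : ∀ᵐ ω ∂M.P, ∀ t ∈ D, L t ω = I t ω + c * J t ω :=
    (ae_ball_iff hDc).2 fun t _ => hfix t t.2
  filter_upwards [hD, hI.continuous, hJ.continuous, hL.continuous] with ω hω h1 h2 h3 t ht
  have := Continuous.ext_on hDd (continuousOn_iff_continuous_domRestrict.1 h3)
    (continuousOn_iff_continuous_domRestrict.1 (h1.add (h2.const_smul c)))
    (fun t ht => hω t ht)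
  exact congrFun this ⟨t, ht⟩

theorem aemeasurable_forwardW_τ (hM : M.Standing) {φ : ℝ → Ω → ℝ}
    (hφ : M.ForwardIntegrableW φ) (hτ : Measurable M.τ) :
    AEMeasurable (fun ω => M.forwardW φ (M.τ ω) ω) M.P := by
  have hv : HasMeasurableVersion M.P M.T (M.forwardW φ) := by
    refine exists_jointly_measurable_of_leftContinuous
      (fun t ht => (hφ.spec.measurable t ht).aemeasurable) ?_
    filter_upwards [hφ.spec.continuous] with ω hω
    exact hω.isCaglad.1
  exact hv.aemeasurable_eval (hφ.spec.measurable 0 ⟨le_rfl, hM.T_pos.le⟩).aemeasurable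
    (measurable_coe_nnreal_real.comp hτ) (fun ω => (M.τ ω).2) hM.τ_le

end Market

/-! ### The jump term -/

/-- The tangent inequality for `x ↦ log (1 + x)`. -/
theorem Real.log_one_add_sub_log_one_add_le {x y : ℝ} (hx : 0 < 1 + x) (hy : 0 < 1 + y) :
    Real.log (1 + y) - Real.log (1 + x) ≤ (y - x) / (1 + x) := by
  rw [← Real.log_div hy.ne' hx.ne']
  refine (Real.log_le_sub_one_of_pos (div_pos hy hx)).trans_eq ?_
  field_simp
  ring

/-- With `x = π θ`, this makes `log (1 + π θ) - π θ` integrable with respect to `ν(dz) ds`. -/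
theorem Real.abs_log_one_add_sub_le {ε x : ℝ} (hε : 0 < ε) (hx : -1 + ε < x) :
    |Real.log (1 + x) - x| ≤ x ^ 2 / ε := by
  have hpos : 0 < 1 + x := by linarith
  have h1 := Real.log_le_sub_one_of_pos hpos
  have h2 := Real.one_sub_inv_le_log_of_pos hpos
  have h3 : x ^ 2 / (1 + x) ≤ x ^ 2 / ε :=
    div_le_div_of_nonneg_left (sq_nonneg x) hε (by linarith)
  have h4 : x - x ^ 2 / (1 + x) = 1 - (1 + x)⁻¹ := by field_simp; ring
  rw [abs_sub_comm, abs_of_nonneg (by linarith)]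
  linarith

/-- With `x = π θ` and `b = β θ`, this makes `β θ / (1 + π θ) - β θ` integrable with respect to
`ν(dz) ds`. -/
theorem abs_div_one_add_sub_le {ε x b : ℝ} (hε : 0 < ε) (hx : -1 + ε < x) :
    |b / (1 + x) - b| ≤ (b ^ 2 + x ^ 2) / ε := by
  have hpos : 0 < 1 + x := by linarith
  have h1 : b / (1 + x) - b = -(b * x) / (1 + x) := by field_simp; ring
  rw [h1, abs_div, abs_of_pos hpos, abs_neg]
  have h2 : |b * x| ≤ b ^ 2 + x ^ 2 := by
    rw [abs_le]; constructor <;> nlinarith [sq_nonneg (b + x), sq_nonneg (b - x)]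
  exact div_le_div₀ (by positivity) h2 hε (by linarith)

theorem MeasureTheory.integral_sub_sub_const_mul {α : Type*} [MeasurableSpace α] {μ : Measure α}
    {f g h : α → ℝ} (c : ℝ) (hf : Integrable f μ) (hg : Integrable g μ) (hh : Integrable h μ) :
    ∫ x, (f x - g x - c * h x) ∂μ = (∫ x, f x ∂μ) - (∫ x, g x ∂μ) - c * ∫ x, h x ∂μ := by
  have hfg : Integrable (fun x => f x - g x) μ := hf.sub hg
  rw [integral_sub hfg (hh.const_mul c), integral_sub hf hg, integral_const_mul]

/-- A Poisson random measure does not charge a null set of its intensity. -/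
theorem IsPoissonRandomMeasure.ae_eq_zero {Ω E : Type*} [MeasurableSpace Ω] [MeasurableSpace E]
    {N : Ω → Measure E} {m : Measure E} {P : Measure Ω} (h : IsPoissonRandomMeasure N m P)
    {B : Set E} (hB : MeasurableSet B) (hm : m B = 0) : ∀ᵐ ω ∂P, N ω B = 0 := by
  have h1 := h.poisson B hB (by simp [hm])
  have h2 : Measurable fun ω => N ω B := (Measure.measurable_coe hB).comp h.measurable
  have h3 : P ((fun ω => N ω B) ⁻¹' {0}ᶜ) = 0 := by
    have hs : MeasurableSet ({0}ᶜ : Set ℝ≥0∞) := (measurableSet_singleton 0).compl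
    rw [← Measure.map_apply h2 hs, h1, Measure.map_apply (by fun_prop) hs]
    simp only [hm, ENNReal.toNNReal_zero]
    rw [poissonMeasure, Measure.sum_apply _ (MeasurableSet.of_discrete)]
    refine ENNReal.tsum_eq_zero.2 fun n => ?_
    rcases n with _ | n <;> simp
  exact h3

namespace Market

variable {Ω : Type*} [MeasurableSpace Ω] {M : Market Ω}

theorem Admissible.hasMeasurableVersion {p : ℝ → Ω → ℝ} (hp : M.Admissible p) :
    HasMeasurableVersion M.P M.T p := by
  refine exists_jointly_measurable_of_leftContinuous (fun t ht => ?_) ?_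
  · have := hp.adapted t.toNNReal (by rw [Real.coe_toNNReal _ ht.1]; exact ht.2)
    rw [Real.coe_toNNReal _ ht.1] at this
    exact (this.mono (M.G.le _) le_rfl).aemeasurable
  · filter_upwards [hp.caglad] with ω hω
    exact hω.1

/-- Almost surely, neither `ν` nor `N` charges the values of `z` where the lower bound on `p θ` may
fail. -/
theorem Admissible.exists_lower_bound {p : ℝ → Ω → ℝ} (hM : M.Standing) (hp : M.Admissible p) :
    ∃ ε > 0, (∀ᵐ ω ∂M.P, ∀ t ∈ Icc 0 M.T, -1 + ε < p t ω * M.κ t ω) ∧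
      ∃ A : Set ℝ, M.ν Aᶜ = 0 ∧ (∀ᵐ ω ∂M.P, M.N ω (Ici 0 ×ˢ Aᶜ) = 0) ∧
        ∀ᵐ ω ∂M.P, ∀ t ∈ Icc 0 M.T, ∀ z ∈ A, -1 + ε < p t ω * M.θ t z ω := by
  obtain ⟨ε, hε, h1, A, hA, hA0, h2⟩ := hp.bound
  have := hM.ν_sigmaFinite
  refine ⟨ε, hε, h1, A, hA0, ?_, h2⟩
  refine hM.poisson.ae_eq_zero (measurableSet_Ici.prod hA.compl) ?_
  rw [Measure.prod_prod, hA0, mul_zero]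

/-- `p θ` is square integrable in `(s, z)`, along almost every path. -/
theorem Admissible.integrable_sq {p : ℝ → Ω → ℝ} (hM : M.Standing) (hp : M.Admissible p) :
    ∀ᵐ ω ∂M.P, Integrable (fun q : ℝ × ℝ => (p q.1 ω * M.θ q.1 q.2 ω) ^ 2)
      ((volume.restrict (Ioc 0 M.T)).prod M.ν) := by
  have := hM.ν_sigmaFinite
  obtain ⟨F, hF, hFp⟩ := hp.hasMeasurableVersion
  have hθ := hM.θ_measurable
  let f : Ω → ℝ → ℝ → ℝ≥0∞ := fun ω s z => ‖M.θ s z ω * F s ω‖ₑ ^ 2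
  have hf : Measurable fun r : (Ω × ℝ) × ℝ => f r.1.1 r.1.2 r.2 := by
    have h1 : Measurable fun r : (Ω × ℝ) × ℝ => M.θ r.1.2 r.2 r.1.1 :=
      hθ.comp ((measurable_snd.comp measurable_fst).prodMk
        (measurable_snd.prodMk (measurable_fst.comp measurable_fst)))
    have h2 : Measurable fun r : (Ω × ℝ) × ℝ => F r.1.2 r.1.1 :=
      hF.comp ((measurable_snd.comp measurable_fst).prodMk (measurable_fst.comp measurable_fst))
    exact (h1.mul h2).enorm.pow_const 2
  have hg : Measurable fun ω => ∫⁻ s in Ioc 0 M.T, ∫⁻ z, f ω s z ∂M.ν :=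
    (hf.lintegral_prod_right' (ν := M.ν)).lintegral_prod_right'
  have hfin : ∀ᵐ ω ∂M.P, ∫⁻ s in Ioc 0 M.T, ∫⁻ z, f ω s z ∂M.ν < ∞ := by
    refine ae_lt_top hg (ne_of_lt (lt_of_le_of_lt (le_of_eq ?_) hp.finite_θ))
    refine lintegral_congr_ae ?_
    filter_upwards [hFp] with ω hω
    refine setLIntegral_congr_fun measurableSet_Ioc fun s hs => ?_
    simp only [f, hω s hs]
  filter_upwards [hfin, hFp] with ω h1 h2
  have hm : Measurable fun q : ℝ × ℝ => M.θ q.1 q.2 ω * F q.1 ω :=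
    (hθ.comp (measurable_fst.prodMk (measurable_snd.prodMk measurable_const))).mul
      (hF.comp (measurable_fst.prodMk measurable_const))
  have hI : Integrable (fun q : ℝ × ℝ => (M.θ q.1 q.2 ω * F q.1 ω) ^ 2)
      ((volume.restrict (Ioc 0 M.T)).prod M.ν) := by
    refine ⟨(hm.pow_const 2).aestronglyMeasurable, ?_⟩
    rw [hasFiniteIntegral_iff_enorm, lintegral_prod _ (hm.pow_const 2).enorm.aemeasurable]
    simpa only [enorm_pow] using h1
  refine hI.congr ?_
  have hae : ∀ᵐ q ∂((volume.restrict (Ioc 0 M.T)).prod M.ν), q.1 ∈ Ioc 0 M.T :=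
    Measure.quasiMeasurePreserving_fst.ae (ae_restrict_mem measurableSet_Ioc)
  filter_upwards [hae] with q hq
  rw [h2 _ hq, mul_comm]

theorem Admissible.aestronglyMeasurable_mul {p : ℝ → Ω → ℝ} (hM : M.Standing)
    (hp : M.Admissible p) : ∀ᵐ ω ∂M.P, AEStronglyMeasurable
      (fun q : ℝ × ℝ => p q.1 ω * M.θ q.1 q.2 ω) ((volume.restrict (Ioc 0 M.T)).prod M.ν) := by
  filter_upwards [hp.caglad] with ω hω
  have := hM.ν_sigmaFinite
  exact (hω.aestronglyMeasurable volume).comp_fst.mul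
    (hM.θ_measurable.comp (measurable_fst.prodMk
      (measurable_snd.prodMk measurable_const))).aestronglyMeasurable

theorem ae_prod_mem {A : Set ℝ} (hM : M.Standing) (hA : M.ν Aᶜ = 0) :
    ∀ᵐ q ∂((volume.restrict (Ioc 0 M.T)).prod M.ν), q.1 ∈ Icc 0 M.T ∧ q.2 ∈ A := by
  have := hM.ν_sigmaFinite
  have h1 : ∀ᵐ q ∂((volume.restrict (Ioc 0 M.T)).prod M.ν), q.1 ∈ Ioc 0 M.T :=
    Measure.quasiMeasurePreserving_fst.ae (ae_restrict_mem measurableSet_Ioc)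
  have h2 : ∀ᵐ q ∂((volume.restrict (Ioc 0 M.T)).prod M.ν), q.2 ∈ A :=
    Measure.quasiMeasurePreserving_snd.ae (show ∀ᵐ z ∂M.ν, z ∈ A from hA)
  filter_upwards [h1, h2] with q hq hq'
  exact ⟨Ioc_subset_Icc_self hq, hq'⟩

theorem Admissible.integrable_log {p : ℝ → Ω → ℝ} (hM : M.Standing) (hp : M.Admissible p) :
    ∀ᵐ ω ∂M.P, Integrable (fun q : ℝ × ℝ =>
      Real.log (1 + p q.1 ω * M.θ q.1 q.2 ω) - p q.1 ω * M.θ q.1 q.2 ω)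
      ((volume.restrict (Ioc 0 M.T)).prod M.ν) := by
  obtain ⟨ε, hε, -, A, hA, -, hb⟩ := hp.exists_lower_bound hM
  filter_upwards [hp.integrable_sq hM, hp.aestronglyMeasurable_mul hM, hb] with ω h1 h2 h3
  refine (h1.div_const ε).mono'
    ((Real.measurable_log.comp_aemeasurable (h2.aemeasurable.const_add 1)).sub
      h2.aemeasurable).aestronglyMeasurable ?_
  filter_upwards [ae_prod_mem hM hA] with q hq
  exact Real.abs_log_one_add_sub_le hε (h3 _ hq.1 _ hq.2)

theorem Admissible.integrable_ψField {p β : ℝ → Ω → ℝ} (hM : M.Standing) (hp : M.Admissible p)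
    (hβ : M.Admissible β) : ∀ᵐ ω ∂M.P, Integrable (fun q : ℝ × ℝ =>
      M.ψField 0 β p q.1 q.2 ω - β q.1 ω * M.θ q.1 q.2 ω)
      ((volume.restrict (Ioc 0 M.T)).prod M.ν) := by
  obtain ⟨ε, hε, -, A, hA, -, hb⟩ := hp.exists_lower_bound hM
  filter_upwards [hp.integrable_sq hM, hp.aestronglyMeasurable_mul hM, hβ.integrable_sq hM,
    hβ.aestronglyMeasurable_mul hM, hb] with ω h1 h2 h3 h4 h5
  simp only [ψField, zero_mul, add_zero]
  refine ((h3.add h1).div_const ε).mono'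
    ((h4.aemeasurable.div (h2.aemeasurable.const_add 1)).sub
      h4.aemeasurable).aestronglyMeasurable ?_
  filter_upwards [ae_prod_mem hM hA] with q hq
  exact abs_div_one_add_sub_le hε (h5 _ hq.1 _ hq.2)

theorem isForwardIntegralN_forwardN {φ : ℝ → ℝ → Ω → ℝ} {S : Ω → ℝ}
    (h : ∃ J, M.IsForwardIntegralN φ S J) : M.IsForwardIntegralN φ S (M.forwardN φ S) := by
  rw [forwardN, dif_pos h]; exact h.choose_spec

/-- An almost sure upper bound, uniform in the truncation, for a linear combination of truncated
integrals passes to the forward integrals. -/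
theorem forwardN_combination_le {φ₁ φ₂ φ₃ : ℝ → ℝ → Ω → ℝ} {S : Ω → ℝ} (c : ℝ) {b : Ω → ℝ}
    (h₁ : ∃ J, M.IsForwardIntegralN φ₁ S J) (h₂ : ∃ J, M.IsForwardIntegralN φ₂ S J)
    (h₃ : ∃ J, M.IsForwardIntegralN φ₃ S J)
    (hb : ∀ᵐ ω ∂M.P, ∀ m, M.truncN φ₁ m (S ω) ω - M.truncN φ₂ m (S ω) ω
      - c * M.truncN φ₃ m (S ω) ω ≤ b ω) :
    ∀ᵐ ω ∂M.P, M.forwardN φ₁ S ω - M.forwardN φ₂ S ω - c * M.forwardN φ₃ S ω ≤ b ω := by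
  have key : ∀ {φ : ℝ → ℝ → Ω → ℝ} (_ : ∃ J, M.IsForwardIntegralN φ S J),
      TendstoInMeasure M.P (fun m ω => M.truncN φ m (S ω) ω) atTop (M.forwardN φ S) := by
    intro φ h
    have h' := isForwardIntegralN_forwardN h
    exact tendstoInMeasure_of_tendsto_eLpNorm two_ne_zero h'.measurable h'.memLp.1 h'.tendsto
  -- extract successively a subsequence along which all three integrals converge almost surely
  obtain ⟨u, hu, h1⟩ := (key h₁).exists_seq_tendsto_ae
  obtain ⟨v, hv, h2⟩ := ((key h₂).comp hu.tendsto_atTop).exists_seq_tendsto_ae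
  obtain ⟨w, hw, h3⟩ :=
    ((key h₃).comp (hu.tendsto_atTop.comp hv.tendsto_atTop)).exists_seq_tendsto_ae
  filter_upwards [h1, h2, h3, hb] with ω g1 g2 g3 hω
  exact le_of_tendsto' (((g1.comp (hv.comp hw).tendsto_atTop).sub
    (g2.comp hw.tendsto_atTop)).sub (g3.const_mul c)) fun m => hω _

/-- The jump part of the log-wealth is concave in the portfolio. Separately, neither the integral
with respect to `ν(dz) ds` nor the one with respect to `Ñ` is: in their sum the compensators
cancel, and what remains is a limit of integrals of a nonpositive field against `N`. -/
theorem jump_part_le (hM : M.Standing) {p p' β : ℝ → Ω → ℝ} {c : ℝ} (hp : M.Admissible p)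
    (hp' : M.Admissible p') (hβ : M.Admissible β) (hpp' : ∀ s ω, p' s ω = p s ω + c * β s ω)
    (hψ : M.ForwardIntegrableN (M.ψField 0 β p)) :
    ∀ᵐ ω ∂M.P,
      (∫ s in Ioc 0 (M.τ ω : ℝ),
          ∫ z, (Real.log (1 + p' s ω * M.θ s z ω) - p' s ω * M.θ s z ω) ∂M.ν)
        + M.forwardN (fun s z ω => Real.log (1 + p' s ω * M.θ s z ω)) (fun ω => M.τ ω) ω
      ≤ (∫ s in Ioc 0 (M.τ ω : ℝ),
          ∫ z, (Real.log (1 + p s ω * M.θ s z ω) - p s ω * M.θ s z ω) ∂M.ν)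
        + M.forwardN (fun s z ω => Real.log (1 + p s ω * M.θ s z ω)) (fun ω => M.τ ω) ω
        + c * ((∫ s in Ioc 0 (M.τ ω : ℝ),
            ∫ z, (M.ψField 0 β p s z ω - β s ω * M.θ s z ω) ∂M.ν)
          + M.forwardN (M.ψField 0 β p) (fun ω => M.τ ω) ω) := by
  have hσ := hM.ν_sigmaFinite
  obtain ⟨ε, hε, -, A, hA, hNA, hb⟩ := hp.exists_lower_bound hM
  obtain ⟨ε', hε', -, A', hA', hNA', hb'⟩ := hp'.exists_lower_bound hM
  let D : Ω → ℝ × ℝ → ℝ := fun ω q => Real.log (1 + p' q.1 ω * M.θ q.1 q.2 ω)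
    - Real.log (1 + p q.1 ω * M.θ q.1 q.2 ω) - c * M.ψField 0 β p q.1 q.2 ω
  have hDle : ∀ᵐ ω ∂M.P, ∀ q : ℝ × ℝ, q.1 ∈ Icc 0 M.T → q.2 ∈ A ∩ A' → D ω q ≤ 0 := by
    filter_upwards [hb, hb'] with ω h1 h2 q hq hqA
    have h3 := h1 _ hq _ hqA.1
    have h4 := h2 _ hq _ hqA.2
    have h5 := Real.log_one_add_sub_log_one_add_le (x := p q.1 ω * M.θ q.1 q.2 ω)
      (y := p' q.1 ω * M.θ q.1 q.2 ω) (by linarith) (by linarith)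
    have h6 : (p' q.1 ω * M.θ q.1 q.2 ω - p q.1 ω * M.θ q.1 q.2 ω) /
        (1 + p q.1 ω * M.θ q.1 q.2 ω) = c * M.ψField 0 β p q.1 q.2 ω := by
      simp only [ψField, hpp', zero_mul, add_zero]; ring
    simp only [D]; linarith
  have hAA : M.ν (A ∩ A')ᶜ = 0 := by
    rw [compl_inter]; exact measure_union_null hA hA'
  have hsub : ∀ ω, Ioc 0 (M.τ ω : ℝ) ⊆ Ioc 0 M.T := fun ω => Ioc_subset_Ioc_right (hM.τ_le ω)
  -- over the whole of `ℝ`, with respect to the intensity measure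
  have hDint : ∀ᵐ ω ∂M.P, IntegrableOn (D ω) (Ioc 0 (M.τ ω : ℝ) ×ˢ univ) (volume.prod M.ν) ∧
      ∫ q in Ioc 0 (M.τ ω : ℝ) ×ˢ univ, D ω q ∂(volume.prod M.ν) =
        (∫ s in Ioc 0 (M.τ ω : ℝ),
          ∫ z, (Real.log (1 + p' s ω * M.θ s z ω) - p' s ω * M.θ s z ω) ∂M.ν)
        - (∫ s in Ioc 0 (M.τ ω : ℝ),
          ∫ z, (Real.log (1 + p s ω * M.θ s z ω) - p s ω * M.θ s z ω) ∂M.ν)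
        - c * ∫ s in Ioc 0 (M.τ ω : ℝ),
            ∫ z, (M.ψField 0 β p s z ω - β s ω * M.θ s z ω) ∂M.ν := by
    filter_upwards [hp'.integrable_log hM, hp.integrable_log hM, hp.integrable_ψField hM hβ]
      with ω h1 h2 h3
    have hr : ∀ {f : ℝ × ℝ → ℝ}, Integrable f ((volume.restrict (Ioc 0 M.T)).prod M.ν) →
        IntegrableOn f (Ioc 0 (M.τ ω : ℝ) ×ˢ univ) (volume.prod M.ν) := by
      intro f hf
      rw [IntegrableOn, ← Measure.prod_restrict, Measure.restrict_univ]
      exact hf.mono_measure (Measure.prod_mono (Measure.restrict_mono (hsub ω) le_rfl) le_rfl)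
    have hi : ∀ {f : ℝ → ℝ → ℝ}, Integrable (fun q : ℝ × ℝ => f q.1 q.2)
        ((volume.restrict (Ioc 0 M.T)).prod M.ν) →
        ∫ s in Ioc 0 (M.τ ω : ℝ), ∫ z, f s z ∂M.ν =
          ∫ q in Ioc 0 (M.τ ω : ℝ) ×ˢ univ, f q.1 q.2 ∂(volume.prod M.ν) := by
      intro f hf
      rw [setIntegral_prod _ (hr hf)]
      simp
    have hD : D ω = fun q : ℝ × ℝ =>
        (Real.log (1 + p' q.1 ω * M.θ q.1 q.2 ω) - p' q.1 ω * M.θ q.1 q.2 ω)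
        - (Real.log (1 + p q.1 ω * M.θ q.1 q.2 ω) - p q.1 ω * M.θ q.1 q.2 ω)
        - c * (M.ψField 0 β p q.1 q.2 ω - β q.1 ω * M.θ q.1 q.2 ω) := by
      ext q
      simp only [D, hpp']; ring
    rw [hi h1, hi h2, hi h3, hD]
    refine ⟨((hr h1).sub (hr h2)).sub ((hr h3).const_mul c), ?_⟩
    exact integral_sub_sub_const_mul c (hr h1) (hr h2) (hr h3)
  -- it remains to compare the truncated integrals with the integral of `D` over all of `ℝ`
  have hcomb := forwardN_combination_le c (S := fun ω => (M.τ ω : ℝ))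
    (b := fun ω => -∫ q in Ioc 0 (M.τ ω : ℝ) ×ˢ univ, D ω q ∂(volume.prod M.ν))
    hp'.forward_log.exists_limit_τ hp.forward_log.exists_limit_τ hψ.exists_limit_τ ?_
  · filter_upwards [hcomb, hDint] with ω h1 h2
    rw [h2.2] at h1
    linarith
  filter_upwards [hDle, hDint, hNA, hNA', ae_all_iff.2 hp'.forward_log.integrableOn,
    ae_all_iff.2 hp.forward_log.integrableOn, ae_all_iff.2 hψ.integrableOn]
    with ω hD hDi hN hN' i1 i2 i3 m
  have hss : Ioc 0 (M.τ ω : ℝ) ×ˢ M.K m ⊆ Ioc 0 M.T ×ˢ M.K m := prod_mono (hsub ω) subset_rfl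
  have e : ∀ {μ : Measure (ℝ × ℝ)},
      IntegrableOn (fun q : ℝ × ℝ => Real.log (1 + p' q.1 ω * M.θ q.1 q.2 ω))
        (Ioc 0 M.T ×ˢ M.K m) μ →
      IntegrableOn (fun q : ℝ × ℝ => Real.log (1 + p q.1 ω * M.θ q.1 q.2 ω))
        (Ioc 0 M.T ×ˢ M.K m) μ →
      IntegrableOn (fun q : ℝ × ℝ => M.ψField 0 β p q.1 q.2 ω) (Ioc 0 M.T ×ˢ M.K m) μ →
      ∫ q in Ioc 0 (M.τ ω : ℝ) ×ˢ M.K m, D ω q ∂μ =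
        (∫ q in Ioc 0 (M.τ ω : ℝ) ×ˢ M.K m, Real.log (1 + p' q.1 ω * M.θ q.1 q.2 ω) ∂μ)
        - (∫ q in Ioc 0 (M.τ ω : ℝ) ×ˢ M.K m, Real.log (1 + p q.1 ω * M.θ q.1 q.2 ω) ∂μ)
        - c * ∫ q in Ioc 0 (M.τ ω : ℝ) ×ˢ M.K m, M.ψField 0 β p q.1 q.2 ω ∂μ := by
    intro μ j1 j2 j3
    exact integral_sub_sub_const_mul c (j1.mono_set hss) (j2.mono_set hss) (j3.mono_set hss)
  have eN := e (i1 m).1 (i2 m).1 (i3 m).1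
  have eν := e (i1 m).2 (i2 m).2 (i3 m).2
  have hKm : MeasurableSet (Ioc 0 (M.τ ω : ℝ) ×ˢ M.K m) :=
    measurableSet_Ioc.prod (hM.K_compact m).measurableSet
  have hNle : ∫ q in Ioc 0 (M.τ ω : ℝ) ×ˢ M.K m, D ω q ∂(M.N ω) ≤ 0 := by
    refine integral_nonpos_of_ae ?_
    have hn : ∀ᵐ q ∂(M.N ω), q ∉ Ici 0 ×ˢ Aᶜ := measure_eq_zero_iff_ae_notMem.1 hN
    have hn' : ∀ᵐ q ∂(M.N ω), q ∉ Ici 0 ×ˢ A'ᶜ := measure_eq_zero_iff_ae_notMem.1 hN'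
    filter_upwards [ae_restrict_of_ae hn, ae_restrict_of_ae hn', ae_restrict_mem hKm]
      with q hq hq' hqK
    have hqt := Ioc_subset_Icc_self (hsub ω hqK.1)
    refine hD q hqt ⟨?_, ?_⟩
    · by_contra hcon; exact hq ⟨hqt.1, hcon⟩
    · by_contra hcon; exact hq' ⟨hqt.1, hcon⟩
  have hνle : ∫ q in Ioc 0 (M.τ ω : ℝ) ×ˢ univ, D ω q ∂(volume.prod M.ν) ≤
      ∫ q in Ioc 0 (M.τ ω : ℝ) ×ˢ M.K m, D ω q ∂(volume.prod M.ν) := by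
    have hae : ∀ᵐ q ∂((volume.prod M.ν).restrict (Ioc 0 (M.τ ω : ℝ) ×ˢ univ)), D ω q ≤ 0 := by
      rw [← Measure.prod_restrict, Measure.restrict_univ]
      have := (Measure.prod_mono (Measure.restrict_mono (hsub ω) (le_refl (volume : Measure ℝ)))
        (le_refl M.ν)).absolutelyContinuous.ae_le (ae_prod_mem hM hAA)
      filter_upwards [this] with q hq
      exact hD q hq.1 hq.2
    have := setIntegral_mono_set (s := Ioc 0 (M.τ ω : ℝ) ×ˢ M.K m)
      (f := fun q => - D ω q) hDi.1.neg
      (by filter_upwards [hae] with q hq; simpa using hq)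
      (LE.le.eventuallyLE (prod_mono subset_rfl (subset_univ _)))
    rw [integral_neg, integral_neg] at this
    linarith
  simp only [truncN]
  linarith

end Market

/-! ### The log-wealth -/

namespace Market

variable {Ω : Type*} [MeasurableSpace Ω] {M : Market Ω}

/-- The base point of the perturbation can be moved to `y`. -/
theorem Ψ_eq_Ψ_zero (y : ℝ) (β π : ℝ → Ω → ℝ) : M.Ψ y β π = M.Ψ 0 β (π + y • β) := by
  have h : M.ψField y β π = M.ψField 0 β (π + y • β) := by
    ext s z ω; simp [ψField]
  ext ω
  simp [Ψ, h]

/-- The integrals against `dH` are sums over finitely many jumps, so that càglàd integrands are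
integrable. -/
theorem default_part_le (hM : M.Standing) {p p' β : ℝ → Ω → ℝ} {c : ℝ} (hp : M.Admissible p)
    (hp' : M.Admissible p') (hβ : M.Admissible β) (hpp' : ∀ s ω, p' s ω = p s ω + c * β s ω) :
    ∀ᵐ ω ∂M.P,
      ∫ s in Ioc 0 (M.τ ω : ℝ), Real.log (1 + M.κ s ω * p' s ω) ∂(M.H ω).measure ≤
        (∫ s in Ioc 0 (M.τ ω : ℝ), Real.log (1 + M.κ s ω * p s ω) ∂(M.H ω).measure)
        + c * ∫ s in Ioc 0 (M.τ ω : ℝ),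
          β s ω * M.κ s ω / (1 + M.κ s ω * p s ω) ∂(M.H ω).measure := by
  obtain ⟨ε, hε, hb, -⟩ := hp.exists_lower_bound hM
  obtain ⟨ε', hε', hb', -⟩ := hp'.exists_lower_bound hM
  filter_upwards [hb, hb', hp.caglad, hp'.caglad, hβ.caglad, hM.κ_caglad]
    with ω h1 h2 c1 c2 c3 ck
  have g1 : ∀ t ∈ Icc 0 M.T, ε ≤ 1 + M.κ t ω * p t ω := fun t ht => by
    linarith [h1 t ht, mul_comm (M.κ t ω) (p t ω)]
  have g2 : ∀ t ∈ Icc 0 M.T, ε' ≤ 1 + M.κ t ω * p' t ω := fun t ht => by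
    linarith [h2 t ht, mul_comm (M.κ t ω) (p' t ω)]
  have hsub : Ioc 0 (M.τ ω : ℝ) ⊆ Ioc 0 M.T := Ioc_subset_Ioc_right (hM.τ_le ω)
  have hi : ∀ {f : ℝ → ℝ}, IsCaglad M.T f →
      IntegrableOn f (Ioc 0 (M.τ ω : ℝ)) (M.H ω).measure := fun hf =>
    (hf.integrableOn (by rw [StieltjesFunction.measure_Ioc]; exact ENNReal.ofReal_ne_top)).mono_set
      hsub
  have i1 := hi (((IsCaglad.const 1).add (ck.mul c1)).log hε g1)
  have i2 := hi (((IsCaglad.const 1).add (ck.mul c2)).log hε' g2)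
  have i3 := hi ((c3.mul ck).mul (((IsCaglad.const 1).add (ck.mul c1)).inv hε g1))
  simp only [← div_eq_mul_inv] at i3
  have hle : ∫ s in Ioc 0 (M.τ ω : ℝ), (Real.log (1 + M.κ s ω * p' s ω)
      - Real.log (1 + M.κ s ω * p s ω)
      - c * (β s ω * M.κ s ω / (1 + M.κ s ω * p s ω))) ∂(M.H ω).measure ≤ 0 := by
    refine setIntegral_nonpos measurableSet_Ioc fun s hs => ?_
    have hs' := Ioc_subset_Icc_self (hsub hs)
    have h5 := Real.log_one_add_sub_log_one_add_le (hε.trans_le (g1 s hs')) (hε'.trans_le (g2 s hs'))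
    have h6 : (M.κ s ω * p' s ω - M.κ s ω * p s ω) / (1 + M.κ s ω * p s ω) =
        c * (β s ω * M.κ s ω / (1 + M.κ s ω * p s ω)) := by
      rw [hpp']; ring
    linarith
  rw [integral_sub_sub_const_mul c i2 i1 i3] at hle
  linarith

/-- The integrand is a quadratic polynomial in the portfolio, with leading coefficient `-σ² / 2`. -/
theorem drift_part_le (hM : M.Standing) {p p' β : ℝ → Ω → ℝ} {c : ℝ} (hp : M.Admissible p)
    (hp' : M.Admissible p') (hβ : M.Admissible β) (hpp' : ∀ s ω, p' s ω = p s ω + c * β s ω) :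
    ∀ᵐ ω ∂M.P,
      ∫ s in Ioc 0 (M.τ ω : ℝ),
        (M.ρ s ω + (M.μ s ω - M.ρ s ω) * p' s ω - 1 / 2 * M.σ s ω ^ 2 * p' s ω ^ 2) ≤
      (∫ s in Ioc 0 (M.τ ω : ℝ),
        (M.ρ s ω + (M.μ s ω - M.ρ s ω) * p s ω - 1 / 2 * M.σ s ω ^ 2 * p s ω ^ 2))
      + c * ∫ s in Ioc 0 (M.τ ω : ℝ),
        β s ω * (M.μ s ω - M.ρ s ω - p s ω * M.σ s ω ^ 2) := by
  filter_upwards [hp.caglad, hp'.caglad, hβ.caglad, hM.ρ_caglad, hM.μ_caglad, hM.σ_caglad]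
    with ω c1 c2 c3 cρ cμ cσ
  have hi : ∀ {f : ℝ → ℝ}, IsCaglad M.T f → IntegrableOn f (Ioc 0 (M.τ ω : ℝ)) := fun hf =>
    (hf.integrableOn (by simp)).mono_set (Ioc_subset_Ioc_right (hM.τ_le ω))
  have hq : ∀ {q : ℝ → ℝ}, IsCaglad M.T q → IntegrableOn (fun s => M.ρ s ω +
      (M.μ s ω - M.ρ s ω) * q s - 1 / 2 * M.σ s ω ^ 2 * q s ^ 2) (Ioc 0 (M.τ ω : ℝ)) := by
    intro q hq
    simp only [sq]
    exact hi ((cρ.add ((cμ.sub cρ).mul hq)).sub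
      (((IsCaglad.const (1 / 2)).mul (cσ.mul cσ)).mul (hq.mul hq)))
  have i3 : IntegrableOn (fun s => β s ω * (M.μ s ω - M.ρ s ω - p s ω * M.σ s ω ^ 2))
      (Ioc 0 (M.τ ω : ℝ)) := by
    simp only [sq]
    exact hi (c3.mul ((cμ.sub cρ).sub (c1.mul (cσ.mul cσ))))
  have hle : ∫ s in Ioc 0 (M.τ ω : ℝ),
      ((M.ρ s ω + (M.μ s ω - M.ρ s ω) * p' s ω - 1 / 2 * M.σ s ω ^ 2 * p' s ω ^ 2)
      - (M.ρ s ω + (M.μ s ω - M.ρ s ω) * p s ω - 1 / 2 * M.σ s ω ^ 2 * p s ω ^ 2)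
      - c * (β s ω * (M.μ s ω - M.ρ s ω - p s ω * M.σ s ω ^ 2))) ≤ 0 := by
    refine integral_nonpos fun s => ?_
    have : 0 ≤ (c * β s ω * M.σ s ω) ^ 2 := sq_nonneg _
    simp only [hpp', Pi.zero_apply]
    nlinarith
  rw [integral_sub_sub_const_mul c (hq c2) (hq c1) i3] at hle
  linarith

theorem forwardW_τ_eq (hM : M.Standing) {p p' β : ℝ → Ω → ℝ} {c : ℝ} (hp : M.Admissible p)
    (hp' : M.Admissible p') (hβ : M.Admissible β) (hpp' : ∀ s ω, p' s ω = p s ω + c * β s ω) :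
    ∀ᵐ ω ∂M.P, M.forwardW (fun s ω => p' s ω * M.σ s ω) (M.τ ω) ω =
      M.forwardW (fun s ω => p s ω * M.σ s ω) (M.τ ω) ω
      + c * M.forwardW (fun s ω => β s ω * M.σ s ω) (M.τ ω) ω := by
  have hσ : HasMeasurableVersion M.P M.T M.σ := .of_measurable hM.σ_measurable
  have e : (fun s ω => p' s ω * M.σ s ω) =
      fun s ω => p s ω * M.σ s ω + c * (β s ω * M.σ s ω) := by
    ext s ω; rw [hpp']; ring
  have h := hp'.forward_σ
  rw [e] at h ⊢
  filter_upwards [forwardW_add_const_mul hM c (hp.hasMeasurableVersion.mul hσ)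
    (hβ.hasMeasurableVersion.mul hσ) hp.caglad_σ hβ.caglad_σ hp.forward_σ hβ.forward_σ h]
    with ω hω
  exact hω _ ⟨(M.τ ω).2, hM.τ_le ω⟩

theorem X_pos (hM : M.Standing) (p : ℝ → Ω → ℝ) (ω : Ω) : 0 < M.X p ω :=
  mul_pos (mul_pos hM.x₀_pos (Real.exp_pos _)) (Real.exp_pos _)

/-- `Ψ(0, β, p)` is a supergradient of the log-wealth at `p` in the direction `β`. -/
theorem log_X_le (hM : M.Standing) {p p' β : ℝ → Ω → ℝ} {c : ℝ} (hp : M.Admissible p)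
    (hp' : M.Admissible p') (hβ : M.Admissible β) (hpp' : ∀ s ω, p' s ω = p s ω + c * β s ω)
    (hψ : M.ForwardIntegrableN (M.ψField 0 β p)) :
    ∀ᵐ ω ∂M.P, Real.log (M.X p' ω) ≤ Real.log (M.X p ω) + c * M.Ψ 0 β p ω := by
  filter_upwards [jump_part_le hM hp hp' hβ hpp' hψ, default_part_le hM hp hp' hβ hpp',
    drift_part_le hM hp hp' hβ hpp', forwardW_τ_eq hM hp hp' hβ hpp'] with ω h1 h2 h3 h4
  have hlog : ∀ a b : ℝ, Real.log (M.x₀ * Real.exp a * Real.exp b) = Real.log M.x₀ + a + b := by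
    intro a b
    rw [Real.log_mul (mul_pos hM.x₀_pos (Real.exp_pos _)).ne' (Real.exp_pos _).ne',
      Real.log_mul hM.x₀_pos.ne' (Real.exp_pos _).ne', Real.log_exp, Real.log_exp]
  simp only [X, wealthτ, hlog, Ψ, zero_mul, add_zero]
  linarith

/-! ### Measurability of the final wealth -/

/-- The restriction of `dH` to the horizon is an s-finite kernel: it is a sum of finite kernels,
each living on the event that there are exactly `n` jumps. -/
theorem exists_kernel_H (hM : M.Standing) : ∃ k : Kernel Ω ℝ, IsSFiniteKernel k ∧
    ∀ ω, k ω = (M.H ω).measure.restrict (Ioc 0 M.T) := by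
  classical
  have hmass : ∀ ω x, (M.H ω).measure.restrict (Ioc 0 M.T) (Iic x) =
      ENNReal.ofReal (M.H ω (min x M.T) - M.H ω 0) := by
    intro ω x
    have : Iic x ∩ Ioc 0 M.T = Ioc 0 (min x M.T) := by
      ext s; simp only [mem_inter_iff, mem_Iic, mem_Ioc, le_min_iff]; tauto
    rw [Measure.restrict_apply measurableSet_Iic, this, StieltjesFunction.measure_Ioc]
  have huniv : ∀ ω, (M.H ω).measure.restrict (Ioc 0 M.T) univ = ENNReal.ofReal (M.H ω M.T) := by
    intro ω
    rw [Measure.restrict_apply_univ, StieltjesFunction.measure_Ioc, hM.H_zero ω 0 le_rfl, sub_zero]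
  have hfin : ∀ ω, IsFiniteMeasure ((M.H ω).measure.restrict (Ioc 0 M.T)) := fun ω =>
    ⟨by rw [huniv]; exact ENNReal.ofReal_lt_top⟩
  have hmeas : Measurable fun ω => (M.H ω).measure.restrict (Ioc 0 M.T) := by
    refine Measurable.measure_of_isPiSystem (borel_eq_generateFrom_Iic ℝ ▸ rfl)
      isPiSystem_Iic ?_ ?_
    · rintro _ ⟨x, rfl⟩
      simp only [hmass]
      exact ((hM.H_measurable _).sub (hM.H_measurable _)).ennreal_ofReal
    · simp only [huniv]
      exact (hM.H_measurable _).ennreal_ofReal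
  let k : Kernel Ω ℝ := ⟨_, hmeas⟩
  have hs : ∀ n : ℕ, MeasurableSet {ω | M.H ω M.T = n} := fun n =>
    hM.H_measurable M.T (measurableSet_singleton _)
  refine ⟨k, ⟨fun n => Kernel.piecewise (hs n) k 0, fun n => ⟨⟨n, by simp, fun ω => ?_⟩⟩, ?_⟩,
    fun _ => rfl⟩
  · rw [Kernel.piecewise_apply']
    split_ifs with h
    · rw [show k ω univ = _ from huniv ω, show M.H ω M.T = n from h]; simp
    · simp
  · ext ω s hsm
    obtain ⟨n, hn⟩ := hM.H_nat ω M.T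
    rw [Kernel.sum_apply' _ _ hsm, tsum_eq_single n]
    · rw [Kernel.piecewise_apply']; exact (if_pos hn).symm
    · intro m hm
      rw [Kernel.piecewise_apply', if_neg]
      · simp
      · intro h
        exact hm (by exact_mod_cast (show M.H ω M.T = m from h).symm.trans hn)

theorem measurable_τ (hM : M.Standing) : Measurable M.τ := by
  refine measurable_of_Iic fun t => ?_
  have := M.G.le _ _ (hM.τ_stopping t)
  simp only [WithTop.coe_le_coe] at this
  exact this

theorem aemeasurable_X (hM : M.Standing) {p : ℝ → Ω → ℝ} (hp : M.Admissible p) :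
    AEMeasurable (M.X p) M.P := by
  have hν := hM.ν_sigmaFinite
  have hτ := measurable_τ hM
  have hτr : Measurable fun ω => (M.τ ω : ℝ) := measurable_coe_nnreal_real.comp hτ
  have hτ0 : ∀ ω, (0 : ℝ) ≤ M.τ ω := fun ω => (M.τ ω).2
  have hv := hp.hasMeasurableVersion
  have hρ : HasMeasurableVersion M.P M.T M.ρ := .of_measurable hM.ρ_measurable
  have hμ : HasMeasurableVersion M.P M.T M.μ := .of_measurable hM.μ_measurable
  have hσ : HasMeasurableVersion M.P M.T M.σ := .of_measurable hM.σ_measurable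
  have hκ : HasMeasurableVersion M.P M.T M.κ := .of_measurable hM.κ_measurable
  have hint : ∀ {f : ℝ → Ω → ℝ}, HasMeasurableVersion M.P M.T f →
      AEMeasurable (fun ω => ∫ s in Ioc 0 (M.τ ω : ℝ), f s ω) M.P := fun hf =>
    hf.aemeasurable_setIntegral (Kernel.const Ω volume) measurable_const hτr (fun _ => le_rfl)
      hM.τ_le
  have m1 : AEMeasurable (fun ω => ∫ s in Ioc 0 (M.τ ω : ℝ),
      (M.ρ s ω + (M.μ s ω - M.ρ s ω) * p s ω - 1 / 2 * M.σ s ω ^ 2 * p s ω ^ 2)) M.P :=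
    hint (.comp₂ (φ := fun x y => x - y) (by fun_prop)
      (hρ.add ((HasMeasurableVersion.comp₂ (φ := fun x y => x - y) (by fun_prop) hμ hρ).mul hv))
      (.comp₂ (φ := fun x y => 1 / 2 * x ^ 2 * y ^ 2) (by fun_prop) hσ hv))
  have m2 : AEMeasurable (fun ω => ∫ s in Ioc 0 (M.τ ω : ℝ),
      ∫ z, (Real.log (1 + p s ω * M.θ s z ω) - p s ω * M.θ s z ω) ∂M.ν) M.P := by
    obtain ⟨F, hF, hFp⟩ := hv
    refine hint ⟨fun s ω => ∫ z, (Real.log (1 + F s ω * M.θ s z ω) - F s ω * M.θ s z ω) ∂M.ν,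
      ?_, ?_⟩
    · have h1 : Measurable fun r : (ℝ × Ω) × ℝ => F r.1.1 r.1.2 * M.θ r.1.1 r.2 r.1.2 :=
        (hF.comp measurable_fst).mul (hM.θ_measurable.comp
          ((measurable_fst.comp measurable_fst).prodMk
            (measurable_snd.prodMk (measurable_snd.comp measurable_fst))))
      have h2 : Measurable fun r : (ℝ × Ω) × ℝ =>
          Real.log (1 + F r.1.1 r.1.2 * M.θ r.1.1 r.2 r.1.2)
            - F r.1.1 r.1.2 * M.θ r.1.1 r.2 r.1.2 :=
        (Real.measurable_log.comp (h1.const_add 1)).sub h1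
      exact (h2.stronglyMeasurable.integral_prod_right' (ν := M.ν)).measurable
    · filter_upwards [hFp] with ω hω s hs
      simp only [hω s hs]
  have m3 := aemeasurable_forwardW_τ hM hp.forward_σ hτ
  have m4 := (isForwardIntegralN_forwardN hp.forward_log.exists_limit_τ).memLp.1.aemeasurable
  have m5 : AEMeasurable (fun ω => ∫ s in Ioc 0 (M.τ ω : ℝ),
      Real.log (1 + M.κ s ω * p s ω) ∂(M.H ω).measure) M.P := by
    obtain ⟨k, _, hk⟩ := exists_kernel_H hM
    have h := (HasMeasurableVersion.comp₂ (φ := fun x y => Real.log (1 + x * y)) (by fun_prop)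
      hκ hv).aemeasurable_setIntegral k measurable_const hτr (fun _ => le_rfl) hM.τ_le
    refine h.congr (Eventually.of_forall fun ω => ?_)
    simp only
    rw [hk, Measure.restrict_restrict measurableSet_Ioc,
      inter_eq_left.2 (Ioc_subset_Ioc_right (hM.τ_le ω))]
  have m6 : AEMeasurable (fun ω => ∫ s in Ioc (M.τ ω : ℝ) M.T, M.ρ s ω) M.P :=
    hρ.aemeasurable_setIntegral (Kernel.const Ω volume) hτr measurable_const hτ0 fun _ => le_rfl
  exact ((Real.measurable_exp.comp_aemeasurable
    ((((m1.add m2).add m3).add m4).add m5)).const_mul _).mul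
    (Real.measurable_exp.comp_aemeasurable m6)

end Market

/-! ### The utility of the final wealth -/

/-- If `x U'(x)` is nonincreasing and `U` is nondecreasing, then `u ↦ U (exp u)` is concave and
nondecreasing, and so lies below its tangents, also after its argument has been increased. -/
theorem comp_le_of_log_le {U : ℝ → ℝ} (h1 : DifferentiableOn ℝ U (Ioi 0))
    (h2 : DifferentiableOn ℝ (deriv U) (Ioi 0)) (hmono : StrictMonoOn U (Ioi 0))
    (hU : ∀ x : ℝ, 0 < x → x * deriv (deriv U) x + deriv U x ≤ 0) {x y d : ℝ} (hx : 0 < x)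
    (hy : 0 < y) (hxy : Real.log y ≤ Real.log x + d) : U y ≤ U x + deriv U x * x * d := by
  have hV : ∀ u, HasDerivAt (fun u => U (Real.exp u)) (deriv U (Real.exp u) * Real.exp u) u :=
    fun u => ((h1.differentiableAt (Ioi_mem_nhds (Real.exp_pos u))).hasDerivAt).comp u
      (Real.hasDerivAt_exp u)
  have hV' : ∀ u, HasDerivAt (fun u => deriv U (Real.exp u) * Real.exp u)
      (deriv (deriv U) (Real.exp u) * Real.exp u * Real.exp u + deriv U (Real.exp u) * Real.exp u)
      u := fun u =>
    (((h2.differentiableAt (Ioi_mem_nhds (Real.exp_pos u))).hasDerivAt).comp u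
      (Real.hasDerivAt_exp u)).mul (Real.hasDerivAt_exp u)
  have hconc : ConcaveOn ℝ univ fun u => U (Real.exp u) := by
    have hder : deriv (fun u => U (Real.exp u)) = fun u => deriv U (Real.exp u) * Real.exp u :=
      funext fun u => (hV u).deriv
    refine Antitone.concaveOn_univ_of_deriv (fun u => (hV u).differentiableAt) ?_
    rw [hder]
    refine antitone_of_deriv_nonpos (fun u => (hV' u).differentiableAt) fun u => ?_
    rw [(hV' u).deriv]
    have := mul_nonpos_of_nonneg_of_nonpos (Real.exp_pos u).le (hU _ (Real.exp_pos u))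
    linarith
  have htan : U (Real.exp (Real.log x + d)) ≤ U x + deriv U x * x * d := by
    have hs := hV (Real.log x)
    rw [Real.exp_log hx] at hs
    rcases lt_trichotomy d 0 with hd | hd | hd
    · have := hconc.le_slope_of_hasDerivAt (mem_univ (Real.log x + d)) (mem_univ (Real.log x))
        (by linarith) hs
      rw [slope_def_field, Real.exp_log hx, le_div_iff₀ (by linarith)] at this
      linarith
    · simp [hd, Real.exp_log hx]
    · have := hconc.slope_le_of_hasDerivAt (mem_univ (Real.log x)) (mem_univ (Real.log x + d))
        (by linarith) hs
      rw [slope_def_field, Real.exp_log hx, div_le_iff₀ (by linarith)] at this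
      linarith
  refine le_trans (hmono.monotoneOn hy (Real.exp_pos _) ?_) htan
  rw [← Real.exp_log hy]
  exact Real.exp_le_exp.2 hxy

theorem mainTheorem7 {Ω : Type*} [MeasurableSpace Ω] (M : Market Ω) (hM : M.Standing)
    (U : ℝ → ℝ) (π : ℝ → Ω → ℝ) (hπ : M.Admissible π)
    (δ : (ℝ → Ω → ℝ) → ℝ) (hUI : M.AssumptionUI U π δ) (hD2 : M.AssumptionD2 U π δ)
    (hU : ∀ x : ℝ, 0 < x → x * deriv (deriv U) x + deriv U x ≤ 0) :
    ∀ β : ℝ → Ω → ℝ, M.Admissible β → M.IsBoundedOnHorizon β →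
      (∀ y ∈ Ioo (-δ β) (δ β), Integrable (fun ω => U (M.X (π + y • β) ω)) M.P) ∧
      ConcaveOn ℝ (Ioo (-δ β) (δ β)) (fun y : ℝ => ∫ ω, U (M.X (π + y • β) ω) ∂M.P) := by
  intro β hβ hβb
  obtain ⟨hδ, hadm, hfwd, hui⟩ := hUI.perturbation β hβ hβb
  let h : ℝ → Ω → ℝ := fun y ω => U (M.X (π + y • β) ω)
  let g : ℝ → Ω → ℝ := fun y ω => deriv U (M.X (π + y • β) ω) * M.X (π + y • β) ω * M.Ψ y β π ω
  -- `g y` is a supergradient of `h` at `y`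
  have hsuper : ∀ y ∈ Ioo (-δ β) (δ β), ∀ y' ∈ Ioo (-δ β) (δ β),
      ∀ᵐ ω ∂M.P, h y' ω ≤ h y ω + (y' - y) * g y ω := by
    intro y hy y' hy'
    have hψ : M.ForwardIntegrableN (M.ψField 0 β (π + y • β)) := by
      have e : M.ψField 0 β (π + y • β) = M.ψField y β π := by
        ext s z ω; simp [Market.ψField]
      rw [e]; exact hfwd y hy
    filter_upwards [Market.log_X_le hM (c := y' - y) (hadm y hy) (hadm y' hy') hβ
      (fun s ω => by simp only [Pi.add_apply, Pi.smul_apply, smul_eq_mul]; ring) hψ] with ω hω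
    rw [← Market.Ψ_eq_Ψ_zero] at hω
    refine (comp_le_of_log_le hD2.differentiable hD2.differentiable_deriv hD2.strictMono hU
      (Market.X_pos hM _ ω) (Market.X_pos hM _ ω) hω).trans_eq ?_
    simp only [h, g]; ring
  have hgi : ∀ y ∈ Ioo (-δ β) (δ β), Integrable (fun ω => |g y ω|) M.P := by
    intro y hy
    have := (memLp_one_iff_integrable.1 (hui.memLp ⟨y, hy⟩)).abs
    simpa only [g, abs_mul, abs_abs] using this
  have h0 : (0 : ℝ) ∈ Ioo (-δ β) (δ β) := ⟨by linarith, hδ⟩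
  have hcont : Continuous fun u => U (Real.exp u) :=
    hD2.differentiable.continuousOn.comp_continuous Real.continuous_exp fun u => Real.exp_pos u
  have hmeas : ∀ y ∈ Ioo (-δ β) (δ β), AEStronglyMeasurable (h y) M.P := by
    intro y hy
    have := (hcont.measurable.comp Real.measurable_log).comp_aemeasurable
      (Market.aemeasurable_X hM (hadm y hy))
    refine (this.congr (Eventually.of_forall fun ω => ?_)).aestronglyMeasurable
    simp only [Function.comp_apply, h, Real.exp_log (Market.X_pos hM _ ω)]
  -- the supergradients at `0` and at `y` control the increment of `h` between these points
  have hint : ∀ y ∈ Ioo (-δ β) (δ β), Integrable (h y) M.P := by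
    intro y hy
    have hi0 : Integrable (h 0) M.P := by simpa [h] using hUI.integrable
    refine (hi0.abs.add (((hgi 0 h0).add (hgi y hy)).const_mul |y|)).mono' (hmeas y hy) ?_
    filter_upwards [hsuper 0 h0 y hy, hsuper y hy 0 h0] with ω h1 h2
    simp only [Pi.add_apply, Real.norm_eq_abs]
    have k0 : (y - 0) * g 0 ω ≤ |y| * |g 0 ω| := by
      rw [sub_zero, ← abs_mul]; exact le_abs_self _
    have k1 : (0 - y) * g y ω ≤ |y| * |g y ω| := by
      rw [← abs_neg y, ← abs_mul, zero_sub]; exact le_abs_self _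
    have k2 : 0 ≤ |y| * |g 0 ω| := by positivity
    have k3 : 0 ≤ |y| * |g y ω| := by positivity
    rw [mul_add, abs_le]
    constructor
    · linarith [neg_abs_le (h 0 ω)]
    · linarith [le_abs_self (h 0 ω)]
  refine ⟨hint, convex_Ioo _ _, fun y₀ hy₀ y₁ hy₁ a b ha hb hab => ?_⟩
  have hy : a • y₀ + b • y₁ ∈ Ioo (-δ β) (δ β) := convex_Ioo _ _ hy₀ hy₁ ha hb hab
  have hle : ∀ᵐ ω ∂M.P, a * h y₀ ω + b * h y₁ ω ≤ h (a • y₀ + b • y₁) ω := by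
    filter_upwards [hsuper _ hy y₀ hy₀, hsuper _ hy y₁ hy₁] with ω h1 h2
    have hz : a * (y₀ - (a • y₀ + b • y₁)) + b * (y₁ - (a • y₀ + b • y₁)) = 0 := by
      obtain rfl : b = 1 - a := by linarith
      simp only [smul_eq_mul]; ring
    set Y := a • y₀ + b • y₁
    have h3 := add_le_add (mul_le_mul_of_nonneg_left h1 ha) (mul_le_mul_of_nonneg_left h2 hb)
    refine h3.trans_eq ?_
    linear_combination (h Y ω) * hab + g Y ω * hz
  calc a • (∫ ω, h y₀ ω ∂M.P) + b • ∫ ω, h y₁ ω ∂M.P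
      = ∫ ω, (a * h y₀ ω + b * h y₁ ω) ∂M.P := by
        rw [integral_add ((hint _ hy₀).const_mul a) ((hint _ hy₁).const_mul b),
          integral_const_mul, integral_const_mul, smul_eq_mul, smul_eq_mul]
    _ ≤ ∫ ω, h (a • y₀ + b • y₁) ω ∂M.P :=
        integral_mono_ae (((hint _ hy₀).const_mul a).add ((hint _ hy₁).const_mul b))
          (hint _ hy) hle
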